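/- Let $[n]=\{1,\dots,n\}$ and let $\mathbb M_n$ be the (finite) set of all matroids with ground set $[n]$. Matroids are counted as labelled objects, not up to isomorphism. A matroid $M$ has $N$ as a minor if some minor $M/C\setminus D$ of $M$ is isomorphic to $N$. Let $U_{r,k}$ be the uniform matroid of rank $r$ on $k$ elements (for $k\ge r$). Let $P_6$, $Q_6$, $R_6$ be the rank-3 matroids on the set $\{0,1,2,3,4,5\}$ in which a 3-element set is a basis unless it is one of the following: for $P_6$, the set $\{0,1,2\}$; for $Q_6$, the sets $\{0,1,2\}$ and $\{0,3,4\}$; for $R_6$, the sets $\{0,1,2\}$ and $\{3,4,5\}$. **Theorem.** If $N=U_{2,k}$ for some $k\ge 2$, or if $N$ is one of $U_{3,6}$, $P_6$, $Q_6$, $R_6$, then $$\lim_{n\to\infty}\frac{\#\{M\in\mathbb M_n : M\text{ does not have }N\text{ as a minor}\}}{\#\mathbb M_n}=0.$$ -/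

import Mathlib

namespace MatroidMinors

/-- Two matroids are isomorphic if some bijection between their ground sets preserves
independence and dependence. -/
def Isomorphic {α β : Type*} (M : Matroid α) (N : Matroid β) : Prop :=
  ∃ e : M.E ≃ N.E, ∀ I : Set M.E,
    M.Indep (Subtype.val '' I) ↔ N.Indep (Subtype.val '' (e '' I))

/-- `M` has `N` as a minor (an `N`-minor): some minor `M ／ C ＼ D` of `M` is isomorphic to `N`. -/
def HasMinor {α β : Type*} (M : Matroid α) (N : Matroid β) : Prop :=
  ∃ M' : Matroid α, M'.IsMinor M ∧ Isomorphic M' N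

/-- The matroid on `Fin n` whose independent sets are the sets with at most `r` elements other than
the members of `C`, where `C` is a family of nonempty `r`-element sets any two of which meet in at
most `r - 2` elements. -/
def sparsePaving (r n : ℕ) (C : Finset (Finset (Fin n))) (hr : 0 < r)
    (hcard : ∀ A ∈ C, A.card = r)
    (hinter : ∀ A ∈ C, ∀ B ∈ C, A ≠ B → (A ∩ B).card + 2 ≤ r) : Matroid (Fin n) :=
  (IndepMatroid.ofFinset Set.univ (fun I => I.card ≤ r ∧ I ∉ C)
    ⟨by simp, fun h => by have := hcard _ h; simp at this; omega⟩
    (by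
      rintro I J ⟨hJ, hJC⟩ hIJ
      refine ⟨(Finset.card_le_card hIJ).trans hJ, fun hI => hJC ?_⟩
      rwa [← Finset.eq_of_subset_of_card_le hIJ (by rw [hcard I hI]; exact hJ)])
    (by
      rintro I J ⟨hI, hIC⟩ ⟨hJ, hJC⟩ hlt
      by_contra! hcon
      have key : ∀ x ∈ J, x ∉ I → insert x I ∈ C := fun x hx hxI => by
        exact hcon x hx hxI (by rw [Finset.card_insert_of_notMem hxI]; omega)
      obtain ⟨x, hx, hxI⟩ := Finset.exists_mem_notMem_of_card_lt_card hlt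
      have hxC := key x hx hxI
      have hc := hcard _ hxC
      rw [Finset.card_insert_of_notMem hxI] at hc
      by_cases hsub : J ⊆ insert x I
      · apply hJC
        rwa [Finset.eq_of_subset_of_card_le hsub
          (by rw [Finset.card_insert_of_notMem hxI]; omega)]
      · obtain ⟨y, hy, hyI⟩ := Finset.not_subset.1 hsub
        have hyI' : y ∉ I := fun h => hyI (Finset.mem_insert_of_mem h)
        have hyC := key y hy hyI'
        have hne : insert x I ≠ insert y I :=
          fun h => hyI (h ▸ Finset.mem_insert_self y I)
        have h1 := hinter _ hxC _ hyC hne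
        have h2 : I.card ≤ (insert x I ∩ insert y I).card := Finset.card_le_card
          (Finset.subset_inter (Finset.subset_insert _ _) (Finset.subset_insert _ _))
        omega)
    (by simp)).matroid

/-- The uniform matroid `U_{r,n}`: the independent sets are the subsets of `Fin n` with at most `r`
elements. -/
def uniform (r n : ℕ) : Matroid (Fin n) :=
  (IndepMatroid.ofFinset Set.univ (fun I => I.card ≤ r) (by simp)
    (fun _ _ hJ hIJ => (Finset.card_le_card hIJ).trans hJ)
    (by
      intro I J _ hJ hlt
      obtain ⟨x, hx, hxI⟩ := Finset.exists_mem_notMem_of_card_lt_card hlt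
      exact ⟨x, hx, hxI, by rw [Finset.card_insert_of_notMem hxI]; omega⟩)
    (by simp)).matroid

/-- `P_6`: six points in the plane whose only collinear triple is `{0, 1, 2}`. -/
def P6 : Matroid (Fin 6) :=
  sparsePaving 3 6 {{0, 1, 2}} (by decide) (by decide) (by decide)

/-- `Q_6`: six points in the plane whose only collinear triples are `{0, 1, 2}` and `{0, 3, 4}`,
two lines with a common point. -/
def Q6 : Matroid (Fin 6) :=
  sparsePaving 3 6 {{0, 1, 2}, {0, 3, 4}} (by decide) (by decide) (by simp)

/-- `R_6`: six points in the plane whose only collinear triples are the disjoint triples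
`{0, 1, 2}` and `{3, 4, 5}`. -/
def R6 : Matroid (Fin 6) :=
  sparsePaving 3 6 {{0, 1, 2}, {3, 4, 5}} (by decide) (by decide) (by simp)

/-- The set `𝕄_n` of all (labelled) matroids whose ground set is the standard `n`-element set. -/
def matroidsOn (n : ℕ) : Set (Matroid (Fin n)) := {M | M.E = Set.univ}

/-- The number of matroids in `𝕄_n` is finite, so that the cardinality `ncard` is meaningful
on subsets of `𝕄_n`. -/
theorem matroidsOn_finite (n : ℕ) : (matroidsOn n).Finite := by
  refine Set.Finite.of_finite_image (f := fun M : Matroid (Fin n) => {I | M.Indep I})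
    (Set.toFinite _) ?_
  intro M hM N hN h
  exact Matroid.ext_indep (hM.trans hN.symm) fun I _ => Set.ext_iff.1 h I

/-- `𝕄_n` is nonempty, so that the fraction below never has denominator zero. -/
theorem matroidsOn_nonempty (n : ℕ) : (matroidsOn n).Nonempty :=
  ⟨Matroid.loopyOn Set.univ, rfl⟩

/-- The fraction of the matroids in `𝕄_n` that do not have `N` as a minor. -/
noncomputable def fractionWithoutMinor {β : Type*} (N : Matroid β) (n : ℕ) : ℝ :=
  ({M ∈ matroidsOn n | ¬ HasMinor M N}.ncard : ℝ) / ((matroidsOn n).ncard : ℝ)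

end MatroidMinors

/-! A matroid of known rank r is recovered from any list of true rank bounds that detects every
dependent r-set (`eq_of_isCover`). So a class whose members all have covers of size x is small: the
logarithm of its size is O(x log n) up to negligible terms (`ncard_le_of_isCover`). Write c for the
central binomial coefficient. All subfamilies of a Graham–Sloane code give sparse paving matroids,
at least 2^(c/n) of them (`two_rpow_le_ncard_matroidsOn`). Hence it suffices that matroids without N
have covers of size o(c/(n log n)).

Such covers are built from one fixed small rank t = s + 1. Avoiding N passes to every contraction
M/S with S independent of size r - t, and a cover of M/S lifts to a cover of the dependent r-sets
containing S (`IsCover.of_contract`). By greedy choice, O(c log n / n^t) + 1 sets S reach all but a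
fraction 1/n^2 of the r-sets (`exists_dominating_subset`); the rest are listed singly. Therefore
covers of size f in rank s + 1 are enough as soon as f log^2 n = o(n^s)
(`tendsto_fractionWithoutMinor`). Extreme ranks cost nothing, since there the number of r-sets is
already at most c/n^2.

For U_{2,k} take t = 2: there are fewer than k parallel classes, so covers have bounded size. For
the six-point matroids take t = 3: loops, parallel classes and lines with at least three points form
a cover, and the point to prove is that a linear space with more than about n^(9/5) lines contains
each pattern (`IsLinearSpace.hasPattern`). Heavy lines are few and become disjoint once their
intersections are deleted. A 3-colouring constant on heavy lines makes many light lines rainbow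
(`IsLinearSpace.exists_coloring`). Rainbow lines supply the required collinear triples, and since
every colour class is large, further points can be added off all lines spanned so far
(`exists_insert`). -/

namespace MatroidMinors
open Finset

/-! ### Counting tools: moment bound, greedy domination, binomial estimates -/

/-- The number of subsets with at most `x` elements, by an exponential moment bound. -/
theorem card_powerset_filter_card_le_mul_rpow {β : Type*} (s : Finset β) {x y : ℝ}
    (hy0 : 0 < y) (hy1 : y ≤ 1) :
    ((s.powerset.filter (fun Z => (Z.card : ℝ) ≤ x)).card : ℝ) * y ^ x ≤ (1 + y) ^ s.card := by
  -- Give Z the weight y^|Z|. All subsets together weigh (1 + y)^|s|, and as y ≤ 1 each counted one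
  -- weighs at least y^x.
  have h := Finset.sum_pow_mul_eq_add_pow y 1 s
  rw [add_comm 1 y, ← h, ← nsmul_eq_mul, ← Finset.sum_const]
  refine (Finset.sum_le_sum (g := fun t => y ^ t.card * 1 ^ (s.card - t.card)) ?_).trans
    (Finset.sum_le_sum_of_subset_of_nonneg (Finset.filter_subset _ _) ?_)
  · intro Z hZ
    rw [one_pow, mul_one, ← Real.rpow_natCast]
    exact Real.rpow_le_rpow_of_exponent_ge hy0 hy1 (Finset.mem_filter.1 hZ).2
  · intros; positivity

/-- If every `b` is related to at least `d` elements of `s`, then some `k` elements of `s`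
leave few elements of `u` without a relative. -/
theorem exists_dominating_subset {A B : Type*} [DecidableEq A] (s : Finset A)
    (u : Finset B) (rel : A → B → Prop) [∀ a b, Decidable (rel a b)] (d : ℕ)
    (h : ∀ b ∈ u, d ≤ (s.filter (fun a => rel a b)).card) (k : ℕ) :
    ∃ T ⊆ s, T.card ≤ k ∧
      ((u.filter (fun b => ∀ a ∈ T, ¬ rel a b)).card : ℝ) ≤
        Real.exp (-(k * (d / s.card))) * u.card := by
  classical
  rcases u.eq_empty_or_nonempty with rfl | ⟨b₀, hb₀⟩
  · exact ⟨∅, by simp, by simp, by simp⟩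
  have hd : d ≤ s.card := (h b₀ hb₀).trans (Finset.card_le_card (Finset.filter_subset _ _))
  have hp : 0 ≤ 1 - (d : ℝ) / s.card :=
    sub_nonneg.2 (div_le_one_of_le₀ (by exact_mod_cast hd) (by positivity))
  suffices H : ∃ T ⊆ s, T.card ≤ k ∧
      ((u.filter (fun b => ∀ a ∈ T, ¬ rel a b)).card : ℝ) ≤ (1 - d / s.card) ^ k * u.card by
    obtain ⟨T, hTs, hTk, hT⟩ := H
    refine ⟨T, hTs, hTk, hT.trans ?_⟩
    rw [← mul_neg, Real.exp_nat_mul]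
    gcongr
    exact Real.one_sub_le_exp_neg _
  induction k with
  | zero => exact ⟨∅, by simp, by simp, by simp⟩
  | succ k ih =>
    obtain ⟨T, hTs, hTk, hT⟩ := ih
    set U := u.filter (fun b => ∀ a ∈ T, ¬ rel a b) with hU
    rcases s.eq_empty_or_nonempty with rfl | hs
    · refine ⟨T, hTs, by omega, ?_⟩
      simpa using hT
    have hsum : ∑ b ∈ U, d ≤ ∑ a ∈ s, (U.filter (fun b => rel a b)).card := by
      refine le_of_le_of_eq ?_
        (Finset.sum_card_bipartiteAbove_eq_sum_card_bipartiteBelow (s := s) (t := U) rel).symm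
      exact Finset.sum_le_sum fun b hb => h b (Finset.mem_filter.1 hb).1
    -- Some a is related to at least the average share d/|s| of the elements still uncovered, so
    -- adding it shrinks them by the factor 1 - d/|s|.
    obtain ⟨a, ha, hle⟩ : ∃ a ∈ s, ((d : ℝ) / s.card) * U.card ≤
        (U.filter (fun b => rel a b)).card := by
      refine Finset.exists_le_of_sum_le hs (f := fun _ => ((d : ℝ) / s.card) * U.card)
        (g := fun a => ((U.filter (fun b => rel a b)).card : ℝ)) ?_
      rw [Finset.sum_const, nsmul_eq_mul]
      have hs' : (s.card : ℝ) ≠ 0 := by simpa using hs.ne_empty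
      have : (s.card : ℝ) * (d / s.card * U.card) = U.card * d := by field_simp
      rw [this]
      rw [Finset.sum_const, smul_eq_mul] at hsum
      exact_mod_cast hsum
    refine ⟨insert a T, Finset.insert_subset ha hTs,
      (Finset.card_insert_le _ _).trans (by omega), ?_⟩
    have heq : u.filter (fun b => ∀ a' ∈ insert a T, ¬ rel a' b) =
        U.filter (fun b => ¬ rel a b) := by
      ext b
      simp only [hU, Finset.mem_filter, Finset.mem_insert, forall_eq_or_imp]
      tauto
    have hc := Finset.card_filter_add_card_filter_not (s := U) (fun b => rel a b)
    rw [heq]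
    have hc' : ((U.filter (fun b => rel a b)).card : ℝ) +
      (U.filter (fun b => ¬ rel a b)).card = U.card := by exact_mod_cast hc
    calc ((U.filter (fun b => ¬ rel a b)).card : ℝ) ≤ (1 - d / s.card) * U.card := by
          linarith
      _ ≤ (1 - d / s.card) * ((1 - d / s.card) ^ k * u.card) := by gcongr
      _ = _ := by ring

/-- Binomial coefficients in the upper third are exponentially smaller than `2 ^ n`. -/
theorem choose_pow_three_le {n r : ℕ} (h : 2 * n ≤ 3 * r) :
    4 ^ n * (n.choose r) ^ 3 ≤ 27 ^ n := by
  -- One term of the expansion of (2 + 1)^n.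
  have h1 : 2 ^ r * n.choose r ≤ 3 ^ n := by
    rcases le_or_gt r n with hr | hr
    · have := add_pow (2 : ℕ) 1 n
      norm_num at this
      rw [this]
      exact Finset.single_le_sum (f := fun m => 2 ^ m * n.choose m) (fun _ _ => Nat.zero_le _)
        (Finset.mem_range.2 (by omega))
    · simp [Nat.choose_eq_zero_of_lt hr]
  calc 4 ^ n * (n.choose r) ^ 3 = 2 ^ (2 * n) * (n.choose r) ^ 3 := by rw [pow_mul]; norm_num
    _ ≤ 2 ^ (3 * r) * (n.choose r) ^ 3 := by gcongr; norm_num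
    _ = (2 ^ r * n.choose r) ^ 3 := by rw [mul_pow, ← pow_mul, mul_comm r 3]
    _ ≤ (3 ^ n) ^ 3 := by gcongr
    _ = 27 ^ n := by rw [← pow_mul, mul_comm, pow_mul]; norm_num

theorem two_pow_le_succ_mul_centralChoose (n : ℕ) : 2 ^ n ≤ (n + 1) * n.choose (n / 2) := by
  rw [← Nat.sum_range_choose]
  refine (Finset.sum_le_card_nsmul _ _ _ fun m _ => Nat.choose_le_middle m n).trans ?_
  simp

end MatroidMinors

/-! ### Many sparse paving matroids from the Graham–Sloane code -/

namespace MatroidMinors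
open Finset

theorem sparsePaving_indep_iff {r n : ℕ} {C : Finset (Finset (Fin n))} {hr : 0 < r}
    {hcard : ∀ A ∈ C, A.card = r}
    {hinter : ∀ A ∈ C, ∀ B ∈ C, A ≠ B → (A ∩ B).card + 2 ≤ r} (I : Finset (Fin n)) :
    (sparsePaving r n C hr hcard hinter).Indep I ↔ I.card ≤ r ∧ I ∉ C := by
  simp [sparsePaving, IndepMatroid.ofFinset_indep]

theorem uniform_indep_iff {r n : ℕ} (I : Finset (Fin n)) :
    (uniform r n).Indep I ↔ I.card ≤ r := by
  unfold uniform
  generalize_proofs h1 h2 h3 h4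
  exact IndepMatroid.ofFinset_indep Set.univ (fun I : Finset (Fin n) => I.card ≤ r) h1 h2 h3 h4

/-- Subsets of `Fin n` of size `r` with prescribed sum modulo `n` (the Graham–Sloane code). -/
def sumCode (n r c : ℕ) : Finset (Finset (Fin n)) :=
  (powersetCard r univ).filter fun A => (∑ i ∈ A, (i : ℕ)) % n = c

/-- Two r-sets meeting in r - 1 elements differ by exchanging one a for one b. Equal sums force a ≡
b mod n, hence a = b. -/
theorem sumCode_inter_card {n r c : ℕ} {A B : Finset (Fin n)} (hA : A ∈ sumCode n r c)
    (hB : B ∈ sumCode n r c) (hne : A ≠ B) : (A ∩ B).card + 2 ≤ r := by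
  simp only [sumCode, mem_filter, mem_powersetCard] at hA hB
  obtain ⟨⟨-, hAr⟩, hAc⟩ := hA
  obtain ⟨⟨-, hBr⟩, hBc⟩ := hB
  by_contra! hlt
  have h1 : (A \ B).card + (A ∩ B).card = r := by rw [Finset.card_sdiff_add_card_inter, hAr]
  have h2 : (B \ A).card + (A ∩ B).card = r := by
    rw [Finset.inter_comm, Finset.card_sdiff_add_card_inter, hBr]
  have h3 : (A \ B).card ≠ 0 := fun h =>
    hne (Finset.eq_of_subset_of_card_le (Finset.sdiff_eq_empty_iff_subset.1
      (Finset.card_eq_zero.1 h)) (by omega))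
  obtain ⟨a, ha⟩ := Finset.card_eq_one.1 (show (A \ B).card = 1 by omega)
  obtain ⟨b, hb⟩ := Finset.card_eq_one.1 (show (B \ A).card = 1 by omega)
  have sA : ∑ i ∈ A, (i : ℕ) = a + ∑ i ∈ A ∩ B, (i : ℕ) := by
    rw [← Finset.sum_inter_add_sum_sdiff A B, ha, Finset.sum_singleton, add_comm]
  have sB : ∑ i ∈ B, (i : ℕ) = b + ∑ i ∈ A ∩ B, (i : ℕ) := by
    rw [← Finset.sum_inter_add_sum_sdiff B A, hb, Finset.sum_singleton, add_comm,
      Finset.inter_comm]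
  have hmod : (a : ℕ) ≡ b [MOD n] := by
    apply Nat.ModEq.add_right_cancel' (∑ i ∈ A ∩ B, (i : ℕ))
    rw [← sA, ← sB]
    exact hAc.trans hBc.symm
  have hab : a = b := Fin.ext (by
    rw [Nat.ModEq, Nat.mod_eq_of_lt a.2, Nat.mod_eq_of_lt b.2] at hmod; exact hmod)
  have haA : a ∈ A \ B := by simp [ha]
  have hbB : b ∈ B \ A := by simp [hb]
  rw [hab] at haA
  exact (Finset.mem_sdiff.1 haA).2 (Finset.mem_sdiff.1 hbB).1

theorem exists_sumCode_card {n : ℕ} (hn : 0 < n) (r : ℕ) :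
    ∃ c, n.choose r ≤ n * (sumCode n r c).card := by
  by_contra! h
  have hmaps : ∀ A ∈ powersetCard r (univ : Finset (Fin n)),
      (∑ i ∈ A, (i : ℕ)) % n ∈ range n := fun A _ => mem_range.2 (Nat.mod_lt _ hn)
  have h1 := Finset.card_eq_sum_card_fiberwise hmaps
  rw [card_powersetCard, card_univ, Fintype.card_fin] at h1
  have h2 : n * n.choose r = ∑ c ∈ range n, n * (sumCode n r c).card := by
    rw [← Finset.mul_sum, h1]; rfl
  have h3 : ∑ c ∈ range n, n * (sumCode n r c).card < ∑ c ∈ range n, n.choose r :=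
    Finset.sum_lt_sum_of_nonempty ⟨0, mem_range.2 hn⟩ fun c _ => h c
  simp at h3
  omega

/-- There are at least `2 ^ (n.choose (n / 2) / n)` matroids on `n` elements. -/
theorem two_rpow_le_ncard_matroidsOn {n : ℕ} (hn : 2 ≤ n) :
    (2 : ℝ) ^ ((n.choose (n / 2) : ℝ) / n) ≤ (matroidsOn n).ncard := by
  classical
  obtain ⟨c, hc⟩ := exists_sumCode_card (show 0 < n by omega) (n / 2)
  set K := sumCode n (n / 2) c with hK
  have hr : 0 < n / 2 := by omega
  have hcard : ∀ C ⊆ K, ∀ A ∈ C, A.card = n / 2 := fun C hC A hA => by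
    have := hC hA
    simp only [hK, sumCode, mem_filter, mem_powersetCard] at this
    exact this.1.2
  have hint : ∀ C ⊆ K, ∀ A ∈ C, ∀ B ∈ C, A ≠ B → (A ∩ B).card + 2 ≤ n / 2 :=
    fun C hC A hA B hB => sumCode_inter_card (hC hA) (hC hB)
  let f : Finset (Finset (Fin n)) → Matroid (Fin n) := fun C =>
    if h : C ⊆ K then sparsePaving (n / 2) n C hr (hcard C h) (hint C h)
      else Matroid.loopyOn Set.univ
  have hcount : 2 ^ K.card ≤ (matroidsOn n).ncard := by
    rw [← card_powerset, ← Set.ncard_coe_finset]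
    refine Set.ncard_le_ncard_of_injOn f ?_ ?_ (matroidsOn_finite n)
    · intro C hC
      have hC : C ⊆ K := by simpa using hC
      simp only [f, hC, dif_pos, matroidsOn, Set.mem_ofPred_eq]
      rfl
    · intro C hC D hD hCD
      have hC : C ⊆ K := by simpa using hC
      have hD : D ⊆ K := by simpa using hD
      simp only [f, hC, hD, dif_pos] at hCD
      ext A
      have key : A.card = n / 2 → (A ∈ C ↔ A ∈ D) := fun hA => by
        have h1 := sparsePaving_indep_iff (hr := hr) (hcard := hcard C hC)
          (hinter := hint C hC) A
        rw [hCD, sparsePaving_indep_iff] at h1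
        have hle : A.card ≤ n / 2 := hA.le
        tauto
      exact ⟨fun h => (key (hcard C hC A h)).1 h, fun h => (key (hcard D hD A h)).2 h⟩
  have hn0 : (0 : ℝ) < n := by positivity
  calc (2 : ℝ) ^ ((n.choose (n / 2) : ℝ) / n) ≤ 2 ^ (K.card : ℝ) := by
        apply Real.rpow_le_rpow_of_exponent_le (by norm_num)
        rw [div_le_iff₀ hn0, mul_comm]
        exact_mod_cast hc
    _ = ((2 ^ K.card : ℕ) : ℝ) := by rw [Real.rpow_natCast]; push_cast; rfl
    _ ≤ _ := by exact_mod_cast hcount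

end MatroidMinors

/-! ### Covers: they determine a matroid, lift from contractions, and bound counts -/

namespace MatroidMinors
open Finset

/-- `M` has a base with exactly `r` elements. -/
def HasRank {α : Type*} (M : Matroid α) (r : ℕ) : Prop := ∃ B : Finset α, M.IsBase B ∧ B.card = r

/-- A family `Z` of rank bounds: every `(F, ρ) ∈ Z` says truthfully that independent sets meet `F`
in at most `ρ` elements, and each dependent `r`-subset of the ground set violates such a bound. -/
def IsCover {α : Type*} [DecidableEq α] (M : Matroid α) (r : ℕ) (Z : Finset (Finset α × ℕ)) :
    Prop :=
  (∀ p ∈ Z, ∀ I : Finset α, M.Indep I → (I ∩ p.1).card ≤ p.2) ∧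
    ∀ X : Finset α, (X : Set α) ⊆ M.E → X.card = r → ¬ M.Indep X → ∃ p ∈ Z, p.2 < (X ∩ p.1).card

section

variable {α : Type*} [DecidableEq α]

theorem HasRank.isBase_iff {α : Type*} [Finite α] {M : Matroid α} {r : ℕ} (hM : HasRank M r) (X : Finset α) :
    M.IsBase X ↔ M.Indep X ∧ X.card = r := by
  obtain ⟨B, hB, hBr⟩ := hM
  constructor
  · intro h
    refine ⟨h.indep, ?_⟩
    have := h.ncard_eq_ncard_of_isBase hB
    rwa [Set.ncard_coe_finset, Set.ncard_coe_finset, hBr] at this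
  · rintro ⟨h, hXr⟩
    obtain ⟨B', hB', hXB'⟩ := h.exists_isBase_superset
    have hc := hB'.ncard_eq_ncard_of_isBase hB
    rw [Set.ncard_coe_finset, hBr, ← hXr, ← Set.ncard_coe_finset] at hc
    rwa [Set.eq_of_subset_of_ncard_le hXB' hc.le (Set.toFinite _)]

theorem exists_hasRank {α : Type*} [Finite α] (M : Matroid α) : ∃ r, HasRank M r := by
  obtain ⟨B, hB⟩ := M.exists_isBase
  exact ⟨_, B.toFinite.toFinset, by simpa using hB, rfl⟩

/-- A matroid is determined by its ground set, its rank, and a cover. -/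
theorem eq_of_isCover [Finite α] {M N : Matroid α} {r : ℕ} {Z : Finset (Finset α × ℕ)}
    (hE : M.E = N.E) (hM : HasRank M r) (hN : HasRank N r) (hMZ : IsCover M r Z)
    (hNZ : IsCover N r Z) : M = N := by
  have aux : ∀ {M N : Matroid α}, M.E = N.E → HasRank M r → HasRank N r → IsCover M r Z →
      IsCover N r Z → ∀ X : Finset α, M.IsBase X → N.IsBase X := by
    intro M N hE hM hN hMZ hNZ X hX
    have h := (hM.isBase_iff X).1 hX
    rw [hN.isBase_iff]
    refine ⟨?_, h.2⟩
    by_contra hcon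
    obtain ⟨p, hp, hlt⟩ := hNZ.2 X (hE ▸ hX.subset_ground) h.2 hcon
    exact absurd (hMZ.1 p hp X h.1) (by omega)
  refine Matroid.ext_isBase hE fun B _ => ?_
  have hB : B = (B.toFinite.toFinset : Set α) := by simp
  rw [hB]
  exact ⟨aux hE hM hN hMZ hNZ _, aux hE.symm hN hM hNZ hMZ _⟩

/-- Bounds that no set can violate detect nothing. Dropping them confines covers to a finite
universe of n·2^n pairs. -/
theorem IsCover.filter_lt [Fintype α] {M : Matroid α} {r : ℕ} {Z : Finset (Finset α × ℕ)}
    (h : IsCover M r Z) : IsCover M r (Z.filter fun p => p.2 < Fintype.card α) := by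
  refine ⟨fun p hp => h.1 p (mem_filter.1 hp).1, fun X hX hr hI => ?_⟩
  obtain ⟨p, hp, hlt⟩ := h.2 X hX hr hI
  exact ⟨p, mem_filter.2 ⟨hp, hlt.trans_le (card_le_univ _)⟩, hlt⟩

/-- The trivial cover by all dependent `r`-sets. -/
theorem exists_isCover_card_le_choose [Fintype α] (M : Matroid α) (r : ℕ) :
    ∃ Z, IsCover M r Z ∧ Z.card ≤ (Fintype.card α).choose r := by
  classical
  refine ⟨((powersetCard r univ).filter fun X : Finset α => ¬ M.Indep X).image fun X => (X, r - 1),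
    ⟨?_, ?_⟩, ?_⟩
  · simp only [mem_image, mem_filter, mem_powersetCard]
    rintro _ ⟨X, ⟨⟨-, hXr⟩, hX⟩, rfl⟩ I hI
    by_contra! hlt
    have hsub : X ⊆ I := by
      have : I ∩ X = X := Finset.eq_of_subset_of_card_le inter_subset_right (by
        simp only at hlt; omega)
      exact this ▸ inter_subset_left
    exact hX (hI.subset (by exact_mod_cast hsub))
  · intro X _ hXr hX
    refine ⟨(X, r - 1), ?_, ?_⟩
    · simp only [mem_image, mem_filter, mem_powersetCard]
      exact ⟨X, ⟨⟨subset_univ _, hXr⟩, hX⟩, rfl⟩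
    · have : r ≠ 0 := by
        rintro rfl
        rw [card_eq_zero] at hXr
        exact hX (by simp [hXr])
      simp only [inter_self]
      omega
  · refine card_image_le.trans ((card_filter_le _ _).trans ?_)
    simp

theorem HasMinor.of_isMinor {α β : Type*} {M M' : Matroid α} {N : Matroid β} (h : HasMinor M' N)
    (hM : M'.IsMinor M) : HasMinor M N :=
  let ⟨L, hL, hiso⟩ := h
  ⟨L, hL.trans hM, hiso⟩

theorem HasRank.contract [Finite α] {M : Matroid α} {r t : ℕ} (hM : HasRank M r) {S : Finset α}
    (hS : M.Indep S) (hSr : S.card + t = r) : HasRank (M.contract S) t := by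
  obtain ⟨B, hB, hSB⟩ := hS.exists_isBase_superset
  have hB' : B = (B.toFinite.toFinset : Set α) := by simp
  have hBr := ((hM.isBase_iff B.toFinite.toFinset).1 (hB' ▸ hB)).2
  have hSB' : S ⊆ B.toFinite.toFinset := by
    intro x hx
    simpa using hSB (by exact_mod_cast hx)
  refine ⟨B.toFinite.toFinset \ S, ?_, ?_⟩
  · rw [hS.contract_isBase_iff, coe_sdiff, ← hB', Set.sdiff_union_of_subset hSB]
    exact ⟨hB, Set.disjoint_sdiff_left⟩
  · rw [card_sdiff_of_subset hSB']
    omega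

/-- A cover of a contraction `M ／ S` yields a cover of the dependent sets containing `S`. -/
theorem IsCover.of_contract [Finite α] {M : Matroid α} {t : ℕ} {S : Finset α}
    {Z : Finset (Finset α × ℕ)} (hS : M.Indep S) (hZ : IsCover (M.contract S) t Z) :
    (∀ p ∈ Z.image fun p => (p.1 ∪ S, p.2 + S.card), ∀ I : Finset α, M.Indep I →
        (I ∩ p.1).card ≤ p.2) ∧
      ∀ X : Finset α, (X : Set α) ⊆ M.E → X.card = S.card + t → ¬ M.Indep X → S ⊆ X →
        ∃ p ∈ Z.image fun p => (p.1 ∪ S, p.2 + S.card), p.2 < (X ∩ p.1).card := by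
  constructor
  · simp only [mem_image]
    rintro _ ⟨⟨F, ρ⟩, hp, rfl⟩ I hI
    simp only
    have hJ0 : M.Indep ((I ∩ (F ∪ S) : Finset α) : Set α) :=
      hI.subset (by exact_mod_cast inter_subset_left)
    by_contra! hlt
    -- Extend S to a basis J of F ∪ S: it is at least as large as I ∩ (F ∪ S), and J \ S is
    -- independent in the contraction, where the bound ρ applies.
    obtain ⟨J, hJ, hSJ, hJsub, hcard⟩ : ∃ J : Finset α, M.Indep J ∧ S ⊆ J ∧
        J ⊆ F ∪ S ∧ (I ∩ (F ∪ S)).card ≤ J.card := by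
      obtain ⟨J, hJ, hSJ⟩ := hS.subset_isBasis'_of_subset
        (X := ((F ∪ S : Finset α) : Set α)) (by exact_mod_cast subset_union_right)
      have hJc : J = (J.toFinite.toFinset : Set α) := by simp
      refine ⟨J.toFinite.toFinset, hJc ▸ hJ.indep, ?_, ?_, ?_⟩
      · rw [← coe_subset, ← hJc]; exact hSJ
      · rw [← coe_subset, ← hJc]; exact hJ.subset
      · have h1 := hJ0.encard_le_eRk_of_subset (X := ((F ∪ S : Finset α) : Set α))
          (by exact_mod_cast inter_subset_right)
        rw [← hJ.encard_eq_eRk, hJc, Set.encard_coe_eq_coe_finsetCard,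
          Set.encard_coe_eq_coe_finsetCard] at h1
        exact_mod_cast h1
    have h1 := hZ.1 (F, ρ) hp (J \ S) (by
      rw [hS.contract_indep_iff, coe_sdiff,
        Set.sdiff_union_of_subset (by exact_mod_cast hSJ)]
      exact ⟨Set.disjoint_sdiff_left, hJ⟩)
    have h2 : (J \ S) ∩ F = J \ S := by
      rw [inter_eq_left]
      intro x hx
      have := hJsub (mem_sdiff.1 hx).1
      simp only [mem_union] at this
      exact this.resolve_right (mem_sdiff.1 hx).2
    rw [h2, card_sdiff_of_subset hSJ] at h1
    simp only at h1
    omega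
  · intro X hXE hXr hX hSX
    obtain ⟨p, hp, hlt⟩ := hZ.2 (X \ S) (by
        rw [Matroid.contract_ground, coe_sdiff]
        exact Set.sdiff_subset_sdiff_left hXE)
      (by rw [card_sdiff_of_subset hSX]; omega)
      (by
        rw [hS.contract_indep_iff, coe_sdiff,
          Set.sdiff_union_of_subset (by exact_mod_cast hSX)]
        exact fun h => hX h.2)
    refine ⟨_, mem_image_of_mem _ hp, ?_⟩
    simp only
    have hsub : ((X \ S) ∩ p.1) ∪ S ⊆ X ∩ (p.1 ∪ S) := by
      intro x
      simp only [mem_union, mem_inter, mem_sdiff]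
      rintro (h | h)
      · exact ⟨h.1.1, Or.inl h.2⟩
      · exact ⟨hSX h, Or.inr h⟩
    have hdis : Disjoint ((X \ S) ∩ p.1) S :=
      disjoint_left.2 fun x hx => (mem_sdiff.1 (mem_inter.1 hx).1).2
    have := card_le_card hsub
    rw [card_union_of_disjoint hdis] at this
    omega

/-- A cover of a matroid of rank `r`, assembled from covers of rank-`t` contractions. -/
theorem exists_isCover_of_contract [Fintype α] {M : Matroid α} {r t : ℕ} {f : ℝ}
    (hf : 0 ≤ f) (ht : t ≤ r)
    (h : ∀ S : Finset α, M.Indep S → S.card + t = r → ∃ Z, IsCover (M.contract S) t Z ∧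
      (Z.card : ℝ) ≤ f) (k : ℕ) :
    ∃ Z, IsCover M r Z ∧ (Z.card : ℝ) ≤ k * (f + 1) +
      Real.exp (-(k * ((r.choose t : ℝ) / (Fintype.card α).choose (r - t)))) *
        (Fintype.card α).choose r := by
  classical
  -- Each r-set contains C(r, r - t) = C(r, t) of the candidate sets S.
  obtain ⟨T, hTs, hTk, hT⟩ := exists_dominating_subset
    (powersetCard (r - t) (univ : Finset α)) (powersetCard r (univ : Finset α))
    (fun S X => S ⊆ X) (r.choose t) (by
      intro X hX
      rw [mem_powersetCard] at hX
      rw [← Nat.choose_symm ht, ← hX.2, ← card_powersetCard]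
      refine card_le_card fun S hS => ?_
      rw [mem_powersetCard] at hS
      simp [mem_powersetCard, hS.1, hS.2, hX.2]) k
  rw [card_powersetCard, card_powersetCard, card_univ] at hT
  set U := (powersetCard r (univ : Finset α)).filter fun X => ∀ a ∈ T, ¬ a ⊆ X with hU
  have hTcard : ∀ S ∈ T, S.card + t = r := fun S hS => by
    have := (mem_powersetCard.1 (hTs hS)).2
    omega
  have hloc : ∀ S : Finset α, ∃ Z : Finset (Finset α × ℕ), S ∈ T → (Z.card : ℝ) ≤ f + 1 ∧
      (∀ p ∈ Z, ∀ I : Finset α, M.Indep I → (I ∩ p.1).card ≤ p.2) ∧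
      ∀ X : Finset α, (X : Set α) ⊆ M.E → X.card = r → ¬ M.Indep X → S ⊆ X →
        ∃ p ∈ Z, p.2 < (X ∩ p.1).card := by
    intro S
    by_cases hST : S ∈ T
    swap
    · exact ⟨∅, fun h => absurd h hST⟩
    by_cases hS : M.Indep S
    · obtain ⟨Z, hZ, hZf⟩ := h S hS (hTcard S hST)
      refine ⟨Z.image fun p => (p.1 ∪ S, p.2 + S.card), fun _ => ⟨?_, ?_⟩⟩
      · have : ((Z.image fun p => (p.1 ∪ S, p.2 + S.card)).card : ℝ) ≤ Z.card := by
          exact_mod_cast card_image_le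
        linarith
      · have := hZ.of_contract hS
        rwa [hTcard S hST] at this
    -- A dependent S cannot be contracted to rank t, but the single bound |S| - 1 on S detects every
    -- X containing it. This accounts for f + 1 instead of f.
    · obtain hS0 : S.card ≠ 0 := by
        intro h0
        rw [card_eq_zero] at h0
        exact hS (by simp [h0])
      refine ⟨{(S, S.card - 1)}, fun _ => ⟨?_, ?_, ?_⟩⟩
      · simp [hf]
      · simp only [mem_singleton, forall_eq]
        intro I hI
        by_contra! hlt
        have : I ∩ S = S := eq_of_subset_of_card_le inter_subset_right (by omega)
        exact hS (hI.subset (by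
          have h2 : S ⊆ I := this ▸ inter_subset_left
          exact_mod_cast h2))
      · intro X _ _ _ hSX
        refine ⟨_, mem_singleton_self _, ?_⟩
        simp only [inter_eq_right.2 hSX]
        omega
  choose Z hZ using hloc
  refine ⟨T.biUnion Z ∪ (U.filter fun X : Finset α => ¬ M.Indep X).image fun X => (X, r - 1),
    ⟨?_, ?_⟩, ?_⟩
  · intro p hp
    rw [mem_union, mem_biUnion] at hp
    rcases hp with ⟨S, hS, hp⟩ | hp
    · exact (hZ S hS).2.1 p hp
    · simp only [mem_image, mem_filter, hU, mem_powersetCard] at hp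
      obtain ⟨X, ⟨⟨⟨-, hXr⟩, -⟩, hX⟩, rfl⟩ := hp
      intro I hI
      by_contra! hlt
      have : I ∩ X = X := eq_of_subset_of_card_le inter_subset_right (by
        simp only at hlt; omega)
      exact hX (hI.subset (by
        have h2 : X ⊆ I := this ▸ inter_subset_left
        exact_mod_cast h2))
  · intro X hXE hXr hX
    by_cases hc : ∃ S ∈ T, S ⊆ X
    · obtain ⟨S, hS, hSX⟩ := hc
      obtain ⟨p, hp, hlt⟩ := (hZ S hS).2.2 X hXE hXr hX hSX
      exact ⟨p, mem_union_left _ (mem_biUnion.2 ⟨S, hS, hp⟩), hlt⟩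
    · push Not at hc
      refine ⟨(X, r - 1), mem_union_right _ (mem_image_of_mem _ ?_), ?_⟩
      · simp only [hU, mem_filter, mem_powersetCard]
        exact ⟨⟨⟨subset_univ _, hXr⟩, hc⟩, hX⟩
      · have : r ≠ 0 := by
          rintro rfl
          rw [card_eq_zero] at hXr
          exact hX (by simp [hXr])
        simp only [inter_self]
        omega
  · have h1 : ((T.biUnion Z).card : ℝ) ≤ k * (f + 1) := by
      calc ((T.biUnion Z).card : ℝ) ≤ ∑ S ∈ T, ((Z S).card : ℝ) := by
            exact_mod_cast card_biUnion_le
        _ ≤ ∑ S ∈ T, (f + 1) := sum_le_sum fun S hS => (hZ S hS).1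
        _ = T.card * (f + 1) := by rw [sum_const, nsmul_eq_mul]
        _ ≤ k * (f + 1) := by gcongr
    have h2 : (((U.filter fun X : Finset α => ¬ M.Indep X).image fun X => (X, r - 1)).card : ℝ) ≤
        U.card := by
      exact_mod_cast card_image_le.trans (card_filter_le _ _)
    have hT' : (U.card : ℝ) ≤ Real.exp (-(k * (r.choose t / (Fintype.card α).choose (r - t)))) *
        (Fintype.card α).choose r := by
      convert hT
    calc _ ≤ ((T.biUnion Z).card : ℝ) +
          ((U.filter fun X : Finset α => ¬ M.Indep X).image fun X => (X, r - 1)).card := by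
          exact_mod_cast card_union_le _ _
      _ ≤ _ := by linarith

end

/-- Counting matroids that have small covers. -/
theorem ncard_le_of_isCover {n : ℕ} {𝓜 : Set (Matroid (Fin n))} (h𝓜 : 𝓜 ⊆ matroidsOn n) {x : ℝ}
    (h : ∀ M ∈ 𝓜, ∀ r, HasRank M r → ∃ Z, IsCover M r Z ∧ (Z.card : ℝ) ≤ x) :
    𝓜.ncard ≤ (n + 1) *
      (((univ : Finset (Finset (Fin n))) ×ˢ range n).powerset.filter
        (fun Z => (Z.card : ℝ) ≤ x)).card := by
  classical
  choose rk hrk using fun M : Matroid (Fin n) => exists_hasRank M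
  have h' : ∀ M : Matroid (Fin n), ∃ Z : Finset (Finset (Fin n) × ℕ), M ∈ 𝓜 →
      IsCover M (rk M) Z ∧ (Z.card : ℝ) ≤ x ∧ Z ⊆ univ ×ˢ range n := by
    intro M
    by_cases hM : M ∈ 𝓜
    · obtain ⟨Z, hZ, hZx⟩ := h M hM _ (hrk M)
      refine ⟨_, fun _ => ⟨hZ.filter_lt, le_trans ?_ hZx, ?_⟩⟩
      · exact_mod_cast card_filter_le _ _
      · intro p hp
        simpa using (mem_filter.1 hp).2
    · exact ⟨∅, fun h => absurd h hM⟩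
  choose cov hcov using h'
  rw [← card_range (n + 1), ← card_product, ← Set.ncard_coe_finset]
  refine Set.ncard_le_ncard_of_injOn (fun M => (rk M, cov M)) ?_ ?_ (Set.toFinite _)
  · intro M hM
    have hr : rk M ≤ n := by
      obtain ⟨B, -, hB⟩ := hrk M
      rw [← hB]
      exact (card_le_univ _).trans (by simp)
    have hr' : rk M ∈ range (n + 1) := mem_range.2 (by omega)
    rw [mem_coe, mem_product]
    exact ⟨by simpa using hr', mem_filter.2 ⟨mem_powerset.2 (hcov M hM).2.2, (hcov M hM).2.1⟩⟩
  · intro M hM N hN hMN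
    simp only [Prod.mk.injEq] at hMN
    have hN' := (hcov N hN).1
    have hNr := hrk N
    rw [← hMN.1] at hN' hNr
    rw [← hMN.2] at hN'
    exact eq_of_isCover ((h𝓜 hM).trans (h𝓜 hN).symm) (hrk M) hNr (hcov M hM).1 hN'

end MatroidMinors

/-! ### Asymptotics: reduction to covers in one fixed rank -/

namespace MatroidMinors
open Finset Filter

theorem tendsto_pow_div_centralChoose (a : ℕ) :
    Tendsto (fun n : ℕ => (n : ℝ) ^ a / n.choose (n / 2)) atTop (nhds 0) := by
  have h := (tendsto_pow_const_div_const_pow_of_one_lt (a + 1) (r := 2) (by norm_num)).const_mul 2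
  rw [mul_zero] at h
  refine squeeze_zero' (Eventually.of_forall fun n => by positivity) ?_ h
  filter_upwards [eventually_ge_atTop 1] with n hn
  have h1 : (2 : ℝ) ^ n ≤ (n + 1) * n.choose (n / 2) := by
    exact_mod_cast two_pow_le_succ_mul_centralChoose n
  have h2 : (0 : ℝ) < n.choose (n / 2) := by
    exact_mod_cast Nat.choose_pos (Nat.div_le_self n 2)
  have hn' : (1 : ℝ) ≤ n := by exact_mod_cast hn
  rw [← mul_div_assoc, div_le_div_iff₀ h2 (by positivity)]
  calc (n : ℝ) ^ a * 2 ^ n ≤ n ^ a * ((n + 1) * n.choose (n / 2)) := by gcongr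
    _ ≤ n ^ a * ((n + n) * n.choose (n / 2)) := by gcongr
    _ = _ := by ring

/-- In this range C(n, r)^3 ≤ (27/4)^n, while the cube of the central coefficient is at least
8^n/(2n)^3. The ratio 8/(27/4) = 32/27 exceeds 1, so any polynomial factor is absorbed. -/
theorem eventually_choose_tail :
    ∀ᶠ n : ℕ in atTop, ∀ r, 2 * n ≤ 3 * r →
      (n.choose r : ℝ) ≤ n.choose (n / 2) / (n : ℝ) ^ 2 := by
  have h := (tendsto_pow_const_div_const_pow_of_one_lt 9 (r := 32 / 27) (by norm_num)).const_mul 8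
  rw [mul_zero] at h
  filter_upwards [h.eventually_le_const (show (0 : ℝ) < 1 by norm_num), eventually_ge_atTop 1]
    with n h1 hn r hr
  have hn' : (1 : ℝ) ≤ n := by exact_mod_cast hn
  rw [← mul_div_assoc, div_le_one (by positivity), div_pow, le_div_iff₀ (by positivity)] at h1
  rw [le_div_iff₀ (by positivity)]
  have h2 : (4 : ℝ) ^ n * (n.choose r) ^ 3 ≤ 27 ^ n := by exact_mod_cast choose_pow_three_le hr
  have h3 : (2 : ℝ) ^ n ≤ (n + 1) * n.choose (n / 2) := by
    exact_mod_cast two_pow_le_succ_mul_centralChoose n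
  have h4 : (2 : ℝ) ^ n ≤ (n + n) * n.choose (n / 2) := h3.trans (by gcongr)
  refine le_of_pow_le_pow_left₀ (n := 3) (by norm_num) (by positivity) ?_
  have h5 : (4 : ℝ) ^ n * (8 * (n : ℝ) ^ 3) * ((n.choose r : ℝ) * (n : ℝ) ^ 2) ^ 3 ≤
      4 ^ n * (8 * (n : ℝ) ^ 3) * (n.choose (n / 2) : ℝ) ^ 3 := by
    calc (4 : ℝ) ^ n * (8 * (n : ℝ) ^ 3) * ((n.choose r : ℝ) * (n : ℝ) ^ 2) ^ 3
        = (8 * (n : ℝ) ^ 9) * (4 ^ n * (n.choose r : ℝ) ^ 3) := by ring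
      _ ≤ (8 * (n : ℝ) ^ 9) * 27 ^ n := by gcongr
      _ ≤ 32 ^ n := h1
      _ = 4 ^ n * ((2 : ℝ) ^ n) ^ 3 := by
          rw [← pow_mul, mul_comm n 3, pow_mul, ← mul_pow]; norm_num
      _ ≤ 4 ^ n * (((n : ℝ) + n) * n.choose (n / 2)) ^ 3 := by gcongr
      _ = _ := by ring
  exact le_of_mul_le_mul_left h5 (by positivity)

/-- The size of covers obtained from covers of size `f` in all rank-`t` contractions. -/
theorem exists_isCover_card_le {n r t : ℕ} (hn : 2 ≤ n) (htr : t ≤ r) (hr : 3 * r ≤ 2 * n)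
    {M : Matroid (Fin n)} {f : ℝ} (hf : 0 ≤ f)
    (h : ∀ S : Finset (Fin n), M.Indep S → S.card + t = r → ∃ Z, IsCover (M.contract S) t Z ∧
      (Z.card : ℝ) ≤ f) :
    ∃ Z, IsCover M r Z ∧ (Z.card : ℝ) ≤
      (2 * 3 ^ t * t.factorial * Real.log n * n.choose (n / 2) / (n : ℝ) ^ t + 1) * (f + 1) +
        n.choose (n / 2) / (n : ℝ) ^ 2 := by
  set p : ℝ := (r.choose t : ℝ) / n.choose (r - t) with hp
  have hn0 : (0 : ℝ) < n := by positivity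
  have hrn : r ≤ n := by omega
  have hA : 0 < n.choose (r - t) := Nat.choose_pos (by omega)
  have hd : 0 < r.choose t := Nat.choose_pos htr
  have hp0 : 0 < p := by positivity
  have hlog : 0 ≤ Real.log n := Real.log_natCast_nonneg n
  have hinv : 1 / p ≤ 3 ^ t * t.factorial * n.choose (n / 2) / (n : ℝ) ^ t := by
    -- Both sides count pairs S ⊆ X with |S| = r - t and |X| = r.
    have h1 : n.choose r * r.choose t = n.choose (r - t) * (n - (r - t)).choose t := by
      have := Nat.choose_mul (n := n) (k := r) (s := r - t) (by omega)
      rwa [Nat.choose_symm htr, show r - (r - t) = t by omega] at this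
    have h2 : (n - (r - t) + 1 - t) ^ t ≤ t.factorial * (n - (r - t)).choose t := by
      rw [← Nat.descFactorial_eq_factorial_mul_choose]
      exact Nat.pow_sub_le_descFactorial _ _
    -- Since 3r ≤ 2n, at least a third of the ground set lies outside an r-set.
    have h3 : n ^ t ≤ 3 ^ t * (t.factorial * (n - (r - t)).choose t) := by
      calc n ^ t ≤ (3 * (n - (r - t) + 1 - t)) ^ t := Nat.pow_le_pow_left (by omega) t
        _ = 3 ^ t * (n - (r - t) + 1 - t) ^ t := mul_pow _ _ _
        _ ≤ _ := Nat.mul_le_mul_left _ h2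
    have h4 : n.choose (r - t) * n ^ t ≤ 3 ^ t * t.factorial * n.choose (n / 2) * r.choose t := by
      calc n.choose (r - t) * n ^ t
          ≤ n.choose (r - t) * (3 ^ t * (t.factorial * (n - (r - t)).choose t)) := by gcongr
        _ = 3 ^ t * t.factorial * (n.choose (r - t) * (n - (r - t)).choose t) := by ring
        _ = 3 ^ t * t.factorial * (n.choose r * r.choose t) := by rw [h1]
        _ ≤ 3 ^ t * t.factorial * (n.choose (n / 2) * r.choose t) := by
            gcongr
            exact Nat.choose_le_middle r n
        _ = _ := by ring
    rw [hp, one_div_div, div_le_div_iff₀ (by positivity) (by positivity)]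
    exact_mod_cast h4
  -- With k ≥ 2 log n / p the uncovered fraction exp(-kp) is at most 1/n^2.
  obtain ⟨Z, hZ, hZc⟩ := exists_isCover_of_contract hf htr h ⌈2 * Real.log n / p⌉₊
  refine ⟨Z, hZ, hZc.trans ?_⟩
  rw [Fintype.card_fin, ← hp]
  have hk1 : (⌈2 * Real.log n / p⌉₊ : ℝ) ≤ 2 * Real.log n / p + 1 :=
    (Nat.ceil_lt_add_one (by positivity)).le
  have hk2 : 2 * Real.log n / p ≤ ⌈2 * Real.log n / p⌉₊ := Nat.le_ceil _
  gcongr ?_ * _ + ?_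
  · calc (⌈2 * Real.log n / p⌉₊ : ℝ) ≤ 2 * Real.log n * (1 / p) + 1 := by
          rw [mul_one_div]; exact hk1
      _ ≤ 2 * Real.log n * (3 ^ t * t.factorial * n.choose (n / 2) / (n : ℝ) ^ t) + 1 := by gcongr
      _ = _ := by ring
  · have h5 : 2 * Real.log n ≤ ⌈2 * Real.log n / p⌉₊ * p := by
      rwa [div_le_iff₀ hp0] at hk2
    have h6 : Real.exp (-(⌈2 * Real.log n / p⌉₊ * p)) ≤ 1 / (n : ℝ) ^ 2 := by
      calc Real.exp (-(⌈2 * Real.log n / p⌉₊ * p)) ≤ Real.exp (-(2 * Real.log n)) := by gcongr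
        _ = 1 / (n : ℝ) ^ 2 := by
          rw [Real.exp_neg, show (2 : ℝ) = ((2 : ℕ) : ℝ) by norm_num, ← Real.log_pow,
            Real.exp_log (by positivity), one_div]
    calc _ ≤ 1 / (n : ℝ) ^ 2 * (n.choose (n / 2) : ℝ) := by
          gcongr
          exact_mod_cast Nat.choose_le_middle r n
      _ = _ := by ring

/-- Almost all matroids have an `N`-minor if the matroids of some rank `s + 1` without
an `N`-minor have small covers. -/
theorem tendsto_fractionWithoutMinor {β : Type*} (N : Matroid β) (s : ℕ) {f : ℕ → ℝ}
    (hf0 : ∀ n, 0 ≤ f n)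
    (hf : Tendsto (fun n : ℕ => (f n + 1) * Real.log n ^ 2 / (n : ℝ) ^ s) atTop (nhds 0))
    (h : ∀ n (M : Matroid (Fin n)), HasRank M (s + 1) → ¬ HasMinor M N →
      ∃ Z, IsCover M (s + 1) Z ∧ (Z.card : ℝ) ≤ f n) :
    Tendsto (fractionWithoutMinor N) atTop (nhds 0) := by
  set c : ℕ → ℝ := fun n => (n.choose (n / 2) : ℝ) with hc
  have hcpos : ∀ n, 0 < c n := fun n => by
    simp only [hc]
    exact_mod_cast Nat.choose_pos (Nat.div_le_self n 2)
  set K : ℝ := 2 * 3 ^ (s + 1) * (s + 1).factorial with hK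
  set x : ℕ → ℝ := fun n =>
    (K * Real.log n * c n / (n : ℝ) ^ (s + 1) + 1) * (f n + 1) + c n / (n : ℝ) ^ 2 with hx
  -- The logarithm of the fraction will be at most (c/n)·b. The summands come from the n + 1 ranks,
  -- from the factor (1 + y)^(n 2^n), from y^(-x), and from the lower bound 2^(c/n). All but -log 2
  -- tend to 0.
  set b : ℕ → ℝ := fun n => n ^ 2 / c n + 2 / (n : ℝ) ^ 2 +
    5 * (K * ((f n + 1) * Real.log n ^ 2 / (n : ℝ) ^ s) +
      (f n + 1) * Real.log n ^ 2 / (n : ℝ) ^ s * (n ^ (s + 1) / c n) + Real.log n / n)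
    - Real.log 2 with hb
  have hcover : ∀ᶠ n : ℕ in atTop, ∀ M ∈ {M ∈ matroidsOn n | ¬ HasMinor M N}, ∀ r, HasRank M r →
      ∃ Z, IsCover M r Z ∧ (Z.card : ℝ) ≤ x n := by
    filter_upwards [eventually_choose_tail, eventually_ge_atTop (3 * (s + 1) + 2)]
      with n htail hn M hM r hr
    have hrn : r ≤ n := by
      obtain ⟨B, -, hB⟩ := hr
      rw [← hB]
      exact (card_le_univ _).trans (by simp)
    have hsmall : c n / (n : ℝ) ^ 2 ≤ x n := by
      have := Real.log_natCast_nonneg n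
      have := hf0 n
      have := hcpos n
      simp only [hx]
      refine le_add_of_nonneg_left ?_
      positivity
    by_cases hr1 : s + 1 ≤ r ∧ 3 * r ≤ 2 * n
    · refine exists_isCover_card_le (by omega) hr1.1 hr1.2 (hf0 n) fun S hS hSr => ?_
      -- The contraction lives on the same type with a smaller ground set, which is why `h` speaks
      -- of all matroids on `Fin n` and not only of those in `matroidsOn n`.
      refine h n _ (hr.contract hS hSr) fun hcon => hM.2 (hcon.of_isMinor ?_)
      exact ⟨S, ∅, by simp⟩
    · obtain ⟨Z, hZ, hZc⟩ := exists_isCover_card_le_choose M r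
      rw [Fintype.card_fin] at hZc
      refine ⟨Z, hZ, le_trans ?_ hsmall⟩
      have hZc' : (Z.card : ℝ) ≤ n.choose r := by exact_mod_cast hZc
      refine hZc'.trans ?_
      by_cases hr2 : 2 * n ≤ 3 * r
      · exact htail r hr2
      · rw [← Nat.choose_symm hrn]
        exact htail (n - r) (by omega)
  have hbound : ∀ᶠ n : ℕ in atTop, fractionWithoutMinor N n ≤ Real.exp (c n / n * b n) := by
    filter_upwards [hcover, eventually_ge_atTop 3] with n hn hn3
    have hn0 : (0 : ℝ) < n := by positivity
    have hn1 : (3 : ℝ) ≤ n := by exact_mod_cast hn3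
    -- Used to absorb the + 1 that rounding leaves in the number of contractions into a factor log
    -- n.
    have hlog : 1 ≤ Real.log n := by
      rw [Real.le_log_iff_exp_le hn0]
      exact Real.exp_one_lt_three.le.trans hn1
    have h1 := ncard_le_of_isCover (Set.sep_subset _ _) hn
    -- With y = n^(-5), (1 + y)^(n 2^n) ≤ exp(2^n/n^4), which is negligible beside exp(c/n), and
    -- y^(-x) costs only exp(5 x log n).
    have hy0 : (0 : ℝ) < 1 / (n : ℝ) ^ 5 := by positivity
    have hy1 : 1 / (n : ℝ) ^ 5 ≤ 1 := by
      rw [div_le_one (by positivity)]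
      exact one_le_pow₀ (by linarith)
    have h2 := card_powerset_filter_card_le_mul_rpow
      ((univ : Finset (Finset (Fin n))) ×ˢ range n) (x := x n) hy0 hy1
    set q := (((univ : Finset (Finset (Fin n))) ×ˢ range n).powerset.filter
        (fun Z => (Z.card : ℝ) ≤ x n)).card
    rw [card_product, card_univ, Fintype.card_finset, Fintype.card_fin, card_range] at h2
    have h3 : (q : ℝ) ≤ Real.exp (2 ^ n / n ^ 4 + 5 * x n * Real.log n) := by
      have hy : (1 / (n : ℝ) ^ 5) ^ x n = Real.exp (-(5 * x n * Real.log n)) := by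
        rw [Real.rpow_def_of_pos hy0, one_div, Real.log_inv, Real.log_pow]
        congr 1
        push_cast
        ring
      have hpow : (1 + 1 / (n : ℝ) ^ 5) ^ (2 ^ n * n) ≤ Real.exp (2 ^ n / n ^ 4) := by
        calc (1 + 1 / (n : ℝ) ^ 5) ^ (2 ^ n * n) ≤ (Real.exp (1 / (n : ℝ) ^ 5)) ^ (2 ^ n * n) := by
              gcongr
              rw [add_comm]
              exact Real.add_one_le_exp _
          _ = _ := by
              rw [← Real.exp_nat_mul]
              congr 1
              push_cast
              field_simp
      rw [hy] at h2
      calc (q : ℝ) = q * Real.exp (-(5 * x n * Real.log n)) * Real.exp (5 * x n * Real.log n) := by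
            rw [mul_assoc, ← Real.exp_add]; simp
        _ ≤ Real.exp (2 ^ n / n ^ 4) * Real.exp (5 * x n * Real.log n) := by
            gcongr
            exact h2.trans hpow
        _ = _ := by rw [Real.exp_add]
    have h4 : (n : ℝ) + 1 ≤ Real.exp n := Real.add_one_le_exp _
    have h5 : ({M ∈ matroidsOn n | ¬ HasMinor M N}.ncard : ℝ) ≤
        Real.exp (n + (2 ^ n / n ^ 4 + 5 * x n * Real.log n)) := by
      calc ({M ∈ matroidsOn n | ¬ HasMinor M N}.ncard : ℝ) ≤ (n + 1) * q := by exact_mod_cast h1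
        _ ≤ Real.exp n * Real.exp (2 ^ n / n ^ 4 + 5 * x n * Real.log n) := by gcongr
        _ = _ := by rw [← Real.exp_add]
    have h6 : Real.exp (c n / n * Real.log 2) ≤ (matroidsOn n).ncard := by
      have := two_rpow_le_ncard_matroidsOn (n := n) (by omega)
      rwa [Real.rpow_def_of_pos (by norm_num), mul_comm] at this
    calc fractionWithoutMinor N n
        ≤ Real.exp (n + (2 ^ n / n ^ 4 + 5 * x n * Real.log n)) /
          Real.exp (c n / n * Real.log 2) := by
          unfold fractionWithoutMinor
          gcongr
      _ = Real.exp (n + (2 ^ n / n ^ 4 + 5 * x n * Real.log n) - c n / n * Real.log 2) := by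
          rw [Real.exp_sub]
      _ ≤ _ := by
        rw [Real.exp_le_exp]
        have hcn := hcpos n
        have hfn := hf0 n
        have e1 : (2 : ℝ) ^ n / n ^ 4 ≤ c n / n * (2 / (n : ℝ) ^ 2) := by
          have h7 : (2 : ℝ) ^ n ≤ (n + 1) * c n := by
            simp only [hc]
            exact_mod_cast two_pow_le_succ_mul_centralChoose n
          calc (2 : ℝ) ^ n / n ^ 4 ≤ ((n + n) * c n) / n ^ 4 := by
                gcongr
                refine h7.trans ?_
                gcongr
                linarith
            _ = _ := by field_simp; norm_num
        have e2 : x n * Real.log n ≤ c n / n * (K * ((f n + 1) * Real.log n ^ 2 / (n : ℝ) ^ s) +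
            (f n + 1) * Real.log n ^ 2 / (n : ℝ) ^ s * (n ^ (s + 1) / c n) + Real.log n / n) := by
          have : c n / n * (K * ((f n + 1) * Real.log n ^ 2 / (n : ℝ) ^ s) +
              (f n + 1) * Real.log n ^ 2 / (n : ℝ) ^ s * (n ^ (s + 1) / c n) + Real.log n / n) =
              (K * Real.log n * c n / (n : ℝ) ^ (s + 1) + Real.log n) * (f n + 1) * Real.log n
                + c n / (n : ℝ) ^ 2 * Real.log n := by
            field_simp
            ring
          rw [this]
          simp only [hx]
          rw [add_mul]
          gcongr
        have e3 : (n : ℝ) = c n / n * (n ^ 2 / c n) := by field_simp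
        have : c n / n * b n = c n / n * (n ^ 2 / c n) + c n / n * (2 / (n : ℝ) ^ 2) +
            5 * (c n / n * (K * ((f n + 1) * Real.log n ^ 2 / (n : ℝ) ^ s) +
            (f n + 1) * Real.log n ^ 2 / (n : ℝ) ^ s * (n ^ (s + 1) / c n) + Real.log n / n))
            - c n / n * Real.log 2 := by
          simp only [hb]; ring
        rw [this, ← e3]
        linarith
  have hlogn : Tendsto (fun n : ℕ => Real.log n / n) atTop (nhds 0) := by
    have := (Real.isLittleO_log_id_atTop.tendsto_div_nhds_zero).comp tendsto_natCast_atTop_atTop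
    exact this
  have hbt : Tendsto b atTop (nhds (-Real.log 2)) := by
    have i1 := tendsto_pow_div_centralChoose 2
    have i2 : Tendsto (fun n : ℕ => 2 / (n : ℝ) ^ 2) atTop (nhds 0) :=
      tendsto_const_nhds.div_atTop ((tendsto_pow_atTop (by norm_num)).comp
        tendsto_natCast_atTop_atTop)
    have i3 := (((hf.const_mul K).add (hf.mul (tendsto_pow_div_centralChoose (s + 1)))).add
      hlogn).const_mul 5
    have := ((i1.add i2).add i3).sub_const (Real.log 2)
    simpa [hb, hc] using this
  have hct : Tendsto (fun n : ℕ => c n / n) atTop atTop := by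
    have := tendsto_pow_div_centralChoose 1
    have h2 : Tendsto (fun n : ℕ => (n : ℝ) ^ 1 / c n) atTop (nhdsWithin 0 (Set.Ioi 0)) := by
      refine tendsto_nhdsWithin_iff.2 ⟨this, ?_⟩
      filter_upwards [eventually_ge_atTop 1] with n hn
      have := hcpos n
      have hn0 : (0 : ℝ) < n := by exact_mod_cast hn
      exact Set.mem_Ioi.2 (by positivity)
    refine h2.inv_tendsto_nhdsGT_zero.congr fun n => ?_
    simp
  have hlim : Tendsto (fun n : ℕ => Real.exp (c n / n * b n)) atTop (nhds 0) :=
    Real.tendsto_exp_atBot.comp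
      (hct.atTop_mul_neg (neg_lt_zero.2 (Real.log_pos (by norm_num))) hbt)
  refine squeeze_zero' (Eventually.of_forall fun n => ?_) hbound hlim
  unfold fractionWithoutMinor
  positivity

end MatroidMinors

/-! ### Linear spaces and the colouring of their points -/

namespace MatroidMinors
open Finset

/-- A family of lines on the point set `V`, each with at least three points, any two distinct
lines meeting in at most one point. -/
structure IsLinearSpace {α : Type*} (V : Finset α) (L : Finset (Finset α)) : Prop where
  subset : ∀ l ∈ L, l ⊆ V
  three_le : ∀ l ∈ L, 3 ≤ l.card
  eq_of_mem : ∀ l ∈ L, ∀ l' ∈ L, ∀ a b, a ≠ b → a ∈ l → b ∈ l → a ∈ l' → b ∈ l' → l = l'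

/-- Six distinct points of `V` whose collinear triples are exactly those prescribed by `C`. -/
def HasPattern {α : Type*} (V : Finset α) (L : Finset (Finset α)) (C : Finset (Finset (Fin 6))) :
    Prop :=
  ∃ p : Fin 6 → α, Function.Injective p ∧ (∀ i, p i ∈ V) ∧
    ∀ T : Finset (Fin 6), T.card = 3 → ((∃ l ∈ L, ∀ i ∈ T, p i ∈ l) ↔ T ∈ C)

/-- A uniformly random 3-colouring takes three prescribed values at three distinct places with
probability 1/27. The injection records the old values there and overwrites them by the prescribed
ones. -/
theorem card_fun_le_mul_card_filter {U : Type*} [Fintype U] [DecidableEq U] {v : Fin 3 → U}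
    (hv : Function.Injective v) :
    Fintype.card (U → Fin 3) ≤
      27 * ((univ : Finset (U → Fin 3)).filter fun f => ∀ i, f (v i) = i).card := by
  have h27 : 27 = (univ : Finset (Fin 3 → Fin 3)).card := by simp
  rw [h27, ← card_product, ← card_univ]
  refine card_le_card_of_injOn (fun f => (f ∘ v, Function.extend v id f)) ?_ ?_
  · intro f _
    simp only [coe_product, Set.mem_prod, mem_coe, mem_univ, true_and, mem_filter]
    exact fun i => hv.extend_apply _ _ i
  · intro f _ g _ hfg
    simp only [Prod.mk.injEq] at hfg
    ext1 x
    by_cases hx : ∃ i, v i = x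
    · obtain ⟨i, rfl⟩ := hx
      exact congrFun hfg.1 i
    · have := congrFun hfg.2 x
      rwa [Function.extend_apply' _ _ _ hx, Function.extend_apply' _ _ _ hx] at this

namespace IsLinearSpace

variable {α : Type*} [DecidableEq α] {V : Finset α} {L : Finset (Finset α)}

theorem card_inter_le_one (h : IsLinearSpace V L) {l l' : Finset α} (hl : l ∈ L) (hl' : l' ∈ L)
    (hne : l ≠ l') : (l ∩ l').card ≤ 1 := by
  rw [card_le_one]
  intro a ha b hb
  rw [mem_inter] at ha hb
  by_contra hab
  exact hne (h.eq_of_mem l hl l' hl' a b hab ha.1 hb.1 ha.2 hb.2)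

/-- Distinct lines through p have distinct second points. -/
theorem card_filter_mem_le (h : IsLinearSpace V L) (p : α) :
    (L.filter fun l => p ∈ l).card ≤ V.card := by
  have hex : ∀ l : Finset α, ∃ x, l ∈ L → x ∈ l ∧ x ≠ p := by
    intro l
    by_cases hl : l ∈ L
    · obtain ⟨x, hx, hxp⟩ := exists_mem_ne (s := l) (by have := h.three_le l hl; omega) p
      exact ⟨x, fun _ => ⟨hx, hxp⟩⟩
    · exact ⟨p, fun h => absurd h hl⟩
  choose g hg using hex
  refine card_le_card_of_injOn g ?_ ?_
  · intro l hl
    have hl' := (mem_filter.1 hl).1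
    exact h.subset l hl' (hg l hl').1
  · intro l hl l' hl' hgg
    rw [mem_coe, mem_filter] at hl hl'
    exact h.eq_of_mem l hl.1 l' hl'.1 p (g l) (hg l hl.1).2.symm hl.2 (hg l hl.1).1 hl'.2
      (hgg ▸ (hg l' hl'.1).1)

/-- Distinct lines share no ordered pair of distinct points, and a line with more than B points uses
at least B^2 of the at most m^2 pairs. -/
theorem card_heavy_le (h : IsLinearSpace V L) {m B H : ℕ} (hm : V.card ≤ m) (hB : 0 < B)
    (hH : m * m ≤ H * (B * B)) : (L.filter fun l => B < l.card).card ≤ H := by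
  have hdisj : ((L.filter fun l => B < l.card : Finset (Finset α)) : Set (Finset α)).PairwiseDisjoint
      (fun l => l.offDiag) := by
    intro l hl l' hl' hne
    rw [mem_coe, mem_filter] at hl hl'
    rw [Function.onFun, disjoint_left]
    rintro ⟨a, b⟩ hab hab'
    rw [mem_offDiag] at hab hab'
    exact hne (h.eq_of_mem l hl.1 l' hl'.1 a b hab.2.2 hab.1 hab.2.1 hab'.1 hab'.2.1)
  have h1 : ((L.filter fun l => B < l.card).biUnion fun l => l.offDiag) ⊆ V ×ˢ V := by
    intro x hx
    simp only [mem_biUnion, mem_filter, mem_offDiag] at hx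
    obtain ⟨l, hl, hx⟩ := hx
    exact mem_product.2 ⟨h.subset l hl.1 hx.1, h.subset l hl.1 hx.2.1⟩
  have h2 := card_le_card h1
  rw [card_biUnion hdisj, card_product] at h2
  have h3 : (L.filter fun l => B < l.card).card * (B * B) ≤
      ∑ l ∈ L.filter fun l => B < l.card, l.offDiag.card := by
    rw [← smul_eq_mul]
    refine card_nsmul_le_sum _ _ _ fun l hl => ?_
    have hl := (mem_filter.1 hl).2
    rw [offDiag_card]
    have : l.card * B + l.card ≤ l.card * l.card := by nlinarith
    have h4 : B * B ≤ l.card * B := Nat.mul_le_mul_right _ hl.le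
    omega
  have h5 : V.card * V.card ≤ m * m := Nat.mul_le_mul hm hm
  exact Nat.le_of_mul_le_mul_right ((h3.trans h2).trans (h5.trans hH)) (Nat.mul_pos hB hB)

/-- After discarding few lines, the points can be 3-coloured such that heavy lines are
monochromatic and the remaining lines are light and carry a marked rainbow triple. -/
theorem exists_coloring [Fintype α] [Nonempty α] (h : IsLinearSpace V L) {m B H : ℕ} (hm : V.card ≤ m)
    (hB : 0 < B) (hH : m * m ≤ H * (B * B)) :
    ∃ V' ⊆ V, ∃ col : α → Fin 3, ∃ L' ⊆ L, ∃ τ : Finset α → Fin 3 → α,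
      (∀ l ∈ L', l.card ≤ B ∧ ∀ i, τ l i ∈ l ∧ τ l i ∈ V' ∧ col (τ l i) = i) ∧
      (∀ l ∈ L, B < l.card → ∀ p ∈ l, ∀ q ∈ l, p ∈ V' → q ∈ V' → col p = col q) ∧
      L.card ≤ H + H * H * m + 27 * L'.card := by
  classical
  set heavy := L.filter fun l => B < l.card with hheavy
  -- J holds the intersections of heavy lines. Deleting it makes heavy lines disjoint, at the price
  -- of discarding the at most H^2·m lines through J.
  set J := heavy.offDiag.biUnion fun x => x.1 ∩ x.2 with hJ
  set bad := J.biUnion fun p => L.filter fun l => p ∈ l with hbad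
  set light := L.filter fun l => l.card ≤ B ∧ ∀ p ∈ l, p ∉ J with hlight
  have hheavyH : heavy.card ≤ H := h.card_heavy_le hm hB hH
  have hJH : J.card ≤ H * H := by
    calc J.card ≤ ∑ x ∈ heavy.offDiag, (x.1 ∩ x.2).card := card_biUnion_le
      _ ≤ ∑ x ∈ heavy.offDiag, 1 := sum_le_sum fun x hx => by
          rw [mem_offDiag] at hx
          exact h.card_inter_le_one (mem_filter.1 hx.1).1 (mem_filter.1 hx.2.1).1 hx.2.2
      _ = heavy.offDiag.card := by simp
      _ ≤ heavy.card * heavy.card := by rw [offDiag_card]; omega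
      _ ≤ H * H := Nat.mul_le_mul hheavyH hheavyH
  have hbadH : bad.card ≤ H * H * m := by
    calc bad.card ≤ ∑ p ∈ J, (L.filter fun l => p ∈ l).card := card_biUnion_le
      _ ≤ ∑ p ∈ J, m := sum_le_sum fun p _ => (h.card_filter_mem_le p).trans hm
      _ = J.card * m := by simp
      _ ≤ H * H * m := Nat.mul_le_mul_right _ hJH
  have hcover : L ⊆ heavy ∪ bad ∪ light := by
    intro l hl
    by_cases h1 : B < l.card
    · exact mem_union_left _ (mem_union_left _ (mem_filter.2 ⟨hl, h1⟩))
    · by_cases h2 : ∃ p ∈ l, p ∈ J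
      · obtain ⟨p, hp, hpJ⟩ := h2
        exact mem_union_left _ (mem_union_right _ (mem_biUnion.2 ⟨p, hpJ, mem_filter.2 ⟨hl, hp⟩⟩))
      · push Not at h2
        exact mem_union_right _ (mem_filter.2 ⟨hl, by omega, h2⟩)
  have hLcard : L.card ≤ heavy.card + bad.card + light.card :=
    (card_le_card hcover).trans ((card_union_le _ _).trans
      (Nat.add_le_add_right (card_union_le _ _) _))
  -- The unit of a point is a heavy line through it, or the point alone if there is none. Colouring
  -- units rather than points makes heavy lines monochromatic off J.
  have hunit : ∃ u : α → Finset α, ∀ p, p ∈ u p ∧ (u p ∈ heavy ∨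
      (u p = {p} ∧ ∀ l ∈ heavy, p ∉ l)) := by
    have : ∀ p : α, ∃ l : Finset α, p ∈ l ∧ (l ∈ heavy ∨ (l = {p} ∧ ∀ l ∈ heavy, p ∉ l)) := by
      intro p
      by_cases hp : ∃ l ∈ heavy, p ∈ l
      · obtain ⟨l, hl, hpl⟩ := hp
        exact ⟨l, hpl, Or.inl hl⟩
      · push Not at hp
        exact ⟨{p}, mem_singleton_self p, Or.inr ⟨rfl, hp⟩⟩
    choose u hu using this
    exact ⟨u, hu⟩
  obtain ⟨u, hu⟩ := hunit
  have hsig : ∀ l : Finset α, ∃ v : Fin 3 → α, l ∈ light → Function.Injective v ∧ ∀ i, v i ∈ l := by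
    intro l
    by_cases hl : l ∈ light
    · have h3 := h.three_le l (mem_filter.1 hl).1
      refine ⟨fun i => l.equivFin.symm (Fin.castLE h3 i), fun _ => ⟨?_, fun i => ?_⟩⟩
      · intro i j hij
        have := l.equivFin.symm.injective (Subtype.ext hij)
        exact Fin.castLE_injective h3 this
      · exact (l.equivFin.symm (Fin.castLE h3 i)).2
    · exact ⟨fun _ => Classical.arbitrary α, fun h => absurd h hl⟩
  choose τ hτ using hsig
  -- Two points of a light line in one unit would lie on a common heavy line, which would then equal
  -- the light line.
  have hinj : ∀ l ∈ light, Function.Injective fun i => u (τ l i) := by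
    intro l hl i j hij
    simp only at hij
    by_contra hne
    have hτne : τ l i ≠ τ l j := fun heq => hne ((hτ l hl).1 heq)
    have h1 := hu (τ l i)
    have h2 := hu (τ l j)
    rw [← hij] at h2
    rcases h1.2 with hh | hh
    · have heq := h.eq_of_mem l (mem_filter.1 hl).1 _ (mem_filter.1 hh).1 _ _ hτne
        ((hτ l hl).2 i) ((hτ l hl).2 j) h1.1 h2.1
      have := (mem_filter.1 hh).2
      rw [← heq] at this
      exact absurd (mem_filter.1 hl).2.1 (by omega)
    · have := h2.1
      rw [hh.1, mem_singleton] at this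
      exact hτne this.symm
  -- Average over all colourings of the units: each light line has its marked triple coloured 0, 1,
  -- 2 with probability at least 1/27.
  obtain ⟨f, hf⟩ : ∃ f : Finset α → Fin 3, light.card ≤
      27 * (light.filter fun l => ∀ i, f (u (τ l i)) = i).card := by
    by_contra! hcon
    have h1 : ∑ f : Finset α → Fin 3, 27 * (light.filter fun l => ∀ i, f (u (τ l i)) = i).card <
        ∑ f : Finset α → Fin 3, light.card :=
      sum_lt_sum_of_nonempty ⟨fun _ => 0, mem_univ _⟩ fun f _ => hcon f
    have h2 : ∑ f : Finset α → Fin 3, (light.filter fun l => ∀ i, f (u (τ l i)) = i).card =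
        ∑ l ∈ light, ((univ : Finset (Finset α → Fin 3)).filter
          fun f => ∀ i, f (u (τ l i)) = i).card :=
      sum_card_bipartiteAbove_eq_sum_card_bipartiteBelow
        (fun (f : Finset α → Fin 3) l => ∀ i, f (u (τ l i)) = i)
    rw [← mul_sum, h2, sum_const, smul_eq_mul, mul_sum] at h1
    have h3 : ∑ l ∈ light, Fintype.card (Finset α → Fin 3) ≤
        ∑ l ∈ light, 27 * ((univ : Finset (Finset α → Fin 3)).filter
          fun f => ∀ i, f (u (τ l i)) = i).card :=
      sum_le_sum fun l hl => card_fun_le_mul_card_filter (hinj l hl)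
    rw [sum_const, smul_eq_mul, ← card_univ, mul_comm] at h3
    omega
  refine ⟨V \ J, sdiff_subset, fun p => f (u p),
    light.filter fun l => ∀ i, f (u (τ l i)) = i,
    (filter_subset _ _).trans (filter_subset _ _), τ, ?_, ?_, ?_⟩
  · intro l hl
    rw [mem_filter] at hl
    have hl1 := mem_filter.1 hl.1
    refine ⟨hl1.2.1, fun i => ⟨(hτ l hl.1).2 i, mem_sdiff.2 ⟨?_, ?_⟩, hl.2 i⟩⟩
    · exact h.subset l hl1.1 ((hτ l hl.1).2 i)
    · exact hl1.2.2 _ ((hτ l hl.1).2 i)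
  · intro l hl hBl
    have hlh : l ∈ heavy := mem_filter.2 ⟨hl, hBl⟩
    have key : ∀ p ∈ l, p ∈ V \ J → u p = l := by
      intro p hp hpV
      rcases (hu p).2 with hh | hh
      · by_contra hne
        exact (mem_sdiff.1 hpV).2 (mem_biUnion.2 ⟨(u p, l), mem_offDiag.2 ⟨hh, hlh, hne⟩,
          mem_inter.2 ⟨(hu p).1, hp⟩⟩)
      · exact absurd hp (hh.2 l hlh)
    intro p hp q hq hpV hqV
    simp only [key p hp hpV, key q hq hqV]
  · omega

end IsLinearSpace

end MatroidMinors

/-! ### Finding the six-point patterns in a linear space with many lines -/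

namespace MatroidMinors
open Finset

/-- All collinear triples of `Q` belong to `D`. -/
def TriplesIn {α : Type*} (L : Finset (Finset α)) (D : Finset (Finset α)) (Q : Finset α) : Prop :=
  ∀ T ⊆ Q, T.card = 3 → (∃ l ∈ L, T ⊆ l) → T ∈ D

section

variable {α : Type*} [DecidableEq α] {V : Finset α} {L : Finset (Finset α)}

/-- A collinear triple through w would place w on a line spanned by two points of Q. -/
theorem TriplesIn.insert {D : Finset (Finset α)} {Q : Finset α} (hQ : TriplesIn L D Q) {w : α}
    (hw : ∀ p ∈ Q, ∀ q ∈ Q, p ≠ q → ∀ l ∈ L, p ∈ l → q ∈ l → w ∉ l) :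
    TriplesIn L D (insert w Q) := by
  rintro T hT hT3 ⟨l, hl, hTl⟩
  by_cases hwT : w ∈ T
  · exfalso
    have h2 : 1 < (T.erase w).card := by rw [card_erase_of_mem hwT]; omega
    obtain ⟨p, hp, q, hq, hpq⟩ := one_lt_card.1 h2
    rw [mem_erase] at hp hq
    exact hw p ((mem_insert.1 (hT hp.2)).resolve_left hp.1) q
      ((mem_insert.1 (hT hq.2)).resolve_left hq.1) hpq l hl (hTl hp.2) (hTl hq.2) (hTl hwT)
  · refine hQ T (fun x hx => (mem_insert.1 (hT hx)).resolve_left ?_) hT3 ⟨l, hl, hTl⟩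
    rintro rfl
    exact hwT hx

theorem TriplesIn.of_card_eq_three {α : Type*} {L : Finset (Finset α)} {Q : Finset α} (hQ : Q.card = 3) : TriplesIn L {Q} Q := by
  rintro T hT hT3 -
  rw [mem_singleton]
  exact eq_of_subset_of_card_le hT (by omega)

theorem TriplesIn.empty {α : Type*} {L : Finset (Finset α)} : TriplesIn L ∅ (∅ : Finset α) := by
  rintro T hT hT3 -
  rw [subset_empty.1 hT] at hT3
  simp at hT3

/-- A third line meets each of the two given lines in at most one point, so it holds at most two
points of A ∪ B. -/
theorem TriplesIn.of_two_lines (h : IsLinearSpace V L) {A B l l' : Finset α} (hl : l ∈ L)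
    (hl' : l' ∈ L) (hA : A.card = 3) (hB : B.card = 3) (hAl : A ⊆ l) (hBl : B ⊆ l')
    (hAB : ∀ y ∈ l, y ∈ l' → y ∈ A ∧ y ∈ B) : TriplesIn L {A, B} (A ∪ B) := by
  rintro T hT hT3 ⟨k, hk, hTk⟩
  rw [mem_insert, mem_singleton]
  by_cases h1 : k = l
  · left
    subst h1
    refine eq_of_subset_of_card_le (fun x hx => ?_) (by omega)
    rcases mem_union.1 (hT hx) with h2 | h2
    · exact h2
    · exact (hAB x (hTk hx) (hBl h2)).1
  by_cases h2 : k = l'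
  · right
    subst h2
    refine eq_of_subset_of_card_le (fun x hx => ?_) (by omega)
    rcases mem_union.1 (hT hx) with h3 | h3
    · exact (hAB x (hAl h3) (hTk hx)).2
    · exact h3
  exfalso
  have h3 : T ⊆ (k ∩ l) ∪ (k ∩ l') := fun x hx => by
    rcases mem_union.1 (hT hx) with h3 | h3
    · exact mem_union_left _ (mem_inter.2 ⟨hTk hx, hAl h3⟩)
    · exact mem_union_right _ (mem_inter.2 ⟨hTk hx, hBl h3⟩)
  have h4 := (card_le_card h3).trans (card_union_le _ _)
  have h5 := h.card_inter_le_one hk hl h1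
  have h6 := h.card_inter_le_one hk hl' h2
  omega

theorem hasPattern_of_triplesIn {C : Finset (Finset (Fin 6))} {p : Fin 6 → α}
    (hp : Function.Injective p) (hV : ∀ i, p i ∈ V)
    (hC : ∀ T ∈ C, ∃ l ∈ L, ∀ i ∈ T, p i ∈ l)
    (hQ : TriplesIn L (C.image fun T => T.image p) (univ.image p)) : HasPattern V L C := by
  refine ⟨p, hp, hV, fun T hT => ⟨?_, hC T⟩⟩
  rintro ⟨l, hl, hTl⟩
  have := hQ (T.image p) (image_subset_image (subset_univ T))
    (by rw [card_image_of_injective _ hp, hT]) ⟨l, hl, image_subset_iff.2 hTl⟩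
  obtain ⟨T', hT', heq⟩ := mem_image.1 this
  rwa [← image_injective hp heq]

/-- Six points in general position up to the triples in `D`, in the form of a function. -/
theorem hasPattern_of_six {C : Finset (Finset (Fin 6))} {Q : Finset α} {D : Finset (Finset α)}
    (p : Fin 6 → α) (hpQ : univ.image p = Q) (hQ6 : Q.card = 6) (hV : Q ⊆ V)
    (hC : ∀ T ∈ C, ∃ l ∈ L, ∀ i ∈ T, p i ∈ l) (hD : (C.image fun T => T.image p) = D)
    (hQ : TriplesIn L D Q) : HasPattern V L C := by
  subst hpQ hD
  have hp : Function.Injective p := by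
    rw [← Set.injOn_univ, ← coe_univ, ← card_image_iff, hQ6]
    simp
  exact hasPattern_of_triplesIn hp (fun i => hV (mem_image_of_mem _ (mem_univ i))) hC hQ

/-- A large colour class contains a point in general position to few given points. -/
theorem exists_insert (h : IsLinearSpace V L) {V' : Finset α} {col : α → Fin 3} {B : ℕ}
    (hB : 0 < B)
    (hmono : ∀ l ∈ L, B < l.card → ∀ p ∈ l, ∀ q ∈ l, p ∈ V' → q ∈ V' → col p = col q)
    {i : Fin 3} (hbig : 26 * B < (V'.filter fun w => col w = i).card)
    {Q : Finset α} (hQV : Q ⊆ V') (hQ5 : Q.card ≤ 5) (hQi : (Q.filter fun w => col w = i).card ≤ 1)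
    {D : Finset (Finset α)} (hQ : TriplesIn L D Q) :
    ∃ w ∈ V', col w = i ∧ w ∉ Q ∧ TriplesIn L D (insert w Q) := by
  classical
  set X := V'.filter fun w => col w = i with hX
  set bad := fun x : α × α => X.filter fun w => ∃ l ∈ L, x.1 ∈ l ∧ x.2 ∈ l ∧ w ∈ l with hbad
  have hbadB : ∀ x ∈ Q.offDiag, (bad x).card ≤ B := by
    rintro ⟨p, q⟩ hpq
    rw [mem_offDiag] at hpq
    simp only at hpq
    rcases (bad (p, q)).eq_empty_or_nonempty with he | ⟨w, hw⟩
    · simp [he]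
    simp only [hbad, mem_filter, hX] at hw
    obtain ⟨⟨hwV, hwi⟩, l, hl, hpl, hql, hwl⟩ := hw
    -- A heavy line through p and q that reaches colour i would give p and q that colour too, but Q
    -- has at most one such point. So only light lines exclude candidates w.
    have hlB : l.card ≤ B := by
      by_contra! hlt
      have h1 := hmono l hl hlt p hpl w hwl (hQV hpq.1) hwV
      have h2 := hmono l hl hlt q hql w hwl (hQV hpq.2.1) hwV
      exact hpq.2.2 (card_le_one.1 hQi p (mem_filter.2 ⟨hpq.1, h1.trans hwi⟩) q
        (mem_filter.2 ⟨hpq.2.1, h2.trans hwi⟩))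
    refine (card_le_card fun y hy => ?_).trans hlB
    simp only [hbad, mem_filter] at hy
    obtain ⟨-, l', hl', hpl', hql', hyl'⟩ := hy
    rwa [h.eq_of_mem l hl l' hl' p q hpq.2.2 hpl hql hpl' hql']
  have hcard : (Q ∪ Q.offDiag.biUnion bad).card < X.card := by
    calc (Q ∪ Q.offDiag.biUnion bad).card ≤ Q.card + ∑ x ∈ Q.offDiag, (bad x).card :=
          (card_union_le _ _).trans (Nat.add_le_add_left card_biUnion_le _)
      _ ≤ Q.card + Q.offDiag.card * B := by
          rw [← smul_eq_mul]
          exact Nat.add_le_add_left (sum_le_card_nsmul _ _ _ hbadB) _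
      _ ≤ 5 + 20 * B := by
          -- Five points give 20 ordered pairs; 5 + 20B excluded points stay below the 26B + 1
          -- available because B ≥ 1.
          have : Q.offDiag.card ≤ 20 := by
            rw [offDiag_card]
            interval_cases Q.card <;> omega
          exact Nat.add_le_add hQ5 (Nat.mul_le_mul_right _ this)
      _ < X.card := by omega
  obtain ⟨w, hwX, hw⟩ := exists_mem_notMem_of_card_lt_card hcard
  rw [mem_union, not_or, mem_biUnion] at hw
  have hwX' := mem_filter.1 hwX
  refine ⟨w, hwX'.1, hwX'.2, hw.1, hQ.insert fun p hp q hq hpq l hl hpl hql hwl => hw.2 ?_⟩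
  exact ⟨(p, q), mem_offDiag.2 ⟨hp, hq, hpq⟩, mem_filter.2 ⟨hwX, l, hl, hpl, hql, hwl⟩⟩

/-- A linear space with many lines contains each of the four patterns. -/
theorem IsLinearSpace.hasPattern [Fintype α] (h : IsLinearSpace V L) {m B H : ℕ} (hm : V.card ≤ m)
    (hB : 0 < B) (hH : m * m ≤ H * (B * B))
    (hL : H + H * H * m + 27 * (26 * B * m + m) < L.card) :
    HasPattern V L ∅ ∧ HasPattern V L {{0, 1, 2}} ∧ HasPattern V L {{0, 1, 2}, {0, 3, 4}} ∧
      HasPattern V L {{0, 1, 2}, {3, 4, 5}} := by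
  classical
  have hne : Nonempty α := by
    obtain ⟨l, hl⟩ := card_pos.1 (show 0 < L.card by omega)
    obtain ⟨x, -⟩ := card_pos.1 (show 0 < l.card by have := h.three_le l hl; omega)
    exact ⟨x⟩
  obtain ⟨V', hV', col, L', hL', τ, hτ, hmono, hcard⟩ := h.exists_coloring hm hB hH
  have hL'card : 26 * B * m + m < L'.card := by omega
  have hτinj : ∀ l ∈ L', ∀ l' ∈ L', ∀ i j, i ≠ j → τ l i = τ l' i → τ l j = τ l' j → l = l' := by
    intro l hl l' hl' i j hij hi hj
    refine h.eq_of_mem l (hL' hl) l' (hL' hl') (τ l i) (τ l j) ?_ ((hτ l hl).2 i).1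
      ((hτ l hl).2 j).1 (hi ▸ ((hτ l' hl').2 i).1) (hj ▸ ((hτ l' hl').2 j).1)
    intro heq
    apply hij
    rw [← ((hτ l hl).2 i).2.2, ← ((hτ l hl).2 j).2.2, heq]
  -- A line of L' is determined by its marked points of colours i and j, so L' has at most |class
  -- i|·m lines.
  have hbig : ∀ i, 26 * B < (V'.filter fun w => col w = i).card := by
    intro i
    obtain ⟨j, hij⟩ := exists_ne i
    have h1 : L'.card ≤ ((V'.filter fun w => col w = i) ×ˢ V).card := by
      refine card_le_card_of_injOn (fun l => (τ l i, τ l j)) ?_ ?_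
      · intro l hl
        rw [mem_coe, mem_product]
        exact ⟨mem_filter.2 ((hτ l hl).2 i).2, hV' ((hτ l hl).2 j).2.1⟩
      · intro l hl l' hl' heq
        rw [Prod.mk.injEq] at heq
        exact hτinj l hl l' hl' i j hij.symm heq.1 heq.2
    rw [card_product] at h1
    by_contra! hle
    have := Nat.mul_le_mul hle hm
    omega
  have ext : ∀ (i : Fin 3) {Q : Finset α}, Q ⊆ V' → Q.card ≤ 5 →
      (Q.filter fun w => col w = i).card ≤ 1 → ∀ {D : Finset (Finset α)}, TriplesIn L D Q →
      ∃ w ∈ V', col w = i ∧ w ∉ Q ∧ TriplesIn L D (insert w Q) :=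
    fun i _ h1 h2 h3 _ h4 => exists_insert h hB hmono (hbig i) h1 h2 h3 h4
  have htriple : ∀ l ∈ L', ({τ l 0, τ l 1, τ l 2} : Finset α).card = 3 := by
    intro l hl
    have c0 := ((hτ l hl).2 0).2.2
    have c1 := ((hτ l hl).2 1).2.2
    have c2 := ((hτ l hl).2 2).2.2
    rw [card_eq_three]
    refine ⟨_, _, _, ?_, ?_, ?_, rfl⟩ <;>
    · intro heq
      simp_all
  obtain ⟨l, hl⟩ := card_pos.1 (show 0 < L'.card by omega)
  -- Adding colours 0, 1, 2 in turn keeps at most one point of the colour about to be added, as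
  -- `exists_insert` demands.
  have extend3 : ∀ {Q : Finset α} {D : Finset (Finset α)}, Q ⊆ V' → Q.card = 3 →
      (∀ i, (Q.filter fun w => col w = i).card ≤ 1) → TriplesIn L D Q → ∃ a b c,
      (insert c (insert b (insert a Q))).card = 6 ∧ insert c (insert b (insert a Q)) ⊆ V' ∧
      TriplesIn L D (insert c (insert b (insert a Q))) := by
    intro Q D hQV hQ3 hQcol hQ
    obtain ⟨a, haV, ha, haQ, hQa⟩ := ext 0 hQV (by omega) (hQcol 0) hQ
    have h1 : insert a Q ⊆ V' := insert_subset haV hQV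
    have h1c : (insert a Q).card = 4 := by rw [card_insert_of_notMem haQ, hQ3]
    obtain ⟨b, hbV, hb, hbQ, hQb⟩ := ext 1 h1 (by omega)
      (by rw [filter_insert, if_neg (by simp [ha])]; exact hQcol 1) hQa
    have h2 : insert b (insert a Q) ⊆ V' := insert_subset hbV h1
    have h2c : (insert b (insert a Q)).card = 5 := by rw [card_insert_of_notMem hbQ, h1c]
    obtain ⟨c, hcV, hc, hcQ, hQc⟩ := ext 2 h2 (by omega)
      (by
        rw [filter_insert, if_neg (by simp [hb]), filter_insert, if_neg (by simp [ha])]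
        exact hQcol 2) hQb
    exact ⟨a, b, c, by rw [card_insert_of_notMem hcQ, h2c], insert_subset hcV h2, hQc⟩
  have himg : ∀ a b c d e g : α, univ.image ![a, b, c, d, e, g] = {g, e, d, a, b, c} := by
    intro a b c d e g
    ext x
    simp [Fin.univ_succ]
    tauto
  refine ⟨?_, ?_, ?_, ?_⟩
  · obtain ⟨x, hxV, hx, -, hQx⟩ := ext 0 (empty_subset V') (by simp) (by simp) TriplesIn.empty
    have h1 : insert x ∅ ⊆ V' := insert_subset hxV (empty_subset _)
    obtain ⟨y, hyV, hy, hyQ, hQy⟩ := ext 1 h1 (by simp)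
      (by rw [filter_insert, if_neg (by simp [hx])]; simp) hQx
    have h2 : insert y (insert x ∅) ⊆ V' := insert_subset hyV h1
    obtain ⟨z, hzV, hz, hzQ, hQz⟩ := ext 2 h2 (by rw [card_insert_of_notMem hyQ]; simp)
      (by rw [filter_insert, if_neg (by simp [hy]), filter_insert, if_neg (by simp [hx])]; simp) hQy
    obtain ⟨a, b, c, h6, hsub, hT⟩ := extend3 (insert_subset hzV h2)
      (by rw [card_insert_of_notMem hzQ, card_insert_of_notMem hyQ]; simp)
      (by
        intro i
        rw [filter_insert, filter_insert, filter_insert, hx, hy, hz]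
        fin_cases i <;> simp) hQz
    refine hasPattern_of_six ![z, y, x, a, b, c] ?_ h6 (hsub.trans hV') (by simp) (by simp) hT
    rw [himg]
    rfl
  · have c0 := ((hτ l hl).2 0).2
    have c1 := ((hτ l hl).2 1).2
    have c2 := ((hτ l hl).2 2).2
    obtain ⟨a, b, c, h6, hsub, hT⟩ := extend3 (Q := {τ l 0, τ l 1, τ l 2})
      (by
        intro x
        simp only [mem_insert, mem_singleton]
        rintro (rfl | rfl | rfl)
        exacts [c0.1, c1.1, c2.1])
      (htriple l hl)
      (by
        intro i
        rw [filter_insert, filter_insert, filter_singleton, c0.2, c1.2, c2.2]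
        fin_cases i <;> simp) (TriplesIn.of_card_eq_three (htriple l hl))
    refine hasPattern_of_six ![τ l 0, τ l 1, τ l 2, a, b, c] (himg _ _ _ _ _ _) h6 (hsub.trans hV')
      ?_ ?_ hT
    · simp only [mem_singleton, forall_eq]
      exact ⟨l, hL' hl, by simp [((hτ l hl).2 _).1]⟩
    · simp [image_insert]
  -- There are more lines than points, so two of them share their marked point of colour 0. It is
  -- then the only point of colour 0 among the five, and the sixth point can be taken of colour 0.
  · obtain ⟨l₁, hl₁, l₂, hl₂, hne12, heq⟩ :
        ∃ l₁ ∈ L', ∃ l₂ ∈ L', l₁ ≠ l₂ ∧ τ l₁ 0 = τ l₂ 0 := by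
      refine exists_ne_map_eq_of_card_lt_of_maps_to (t := V) ?_
        (fun l hl => hV' ((hτ l hl).2 0).2.1)
      have : m ≤ 26 * B * m + m := by omega
      omega
    have a0 := (hτ l₁ hl₁).2 0
    have a1 := (hτ l₁ hl₁).2 1
    have a2 := (hτ l₁ hl₁).2 2
    have b0 := (hτ l₂ hl₂).2 0
    have b1 := (hτ l₂ hl₂).2 1
    have b2 := (hτ l₂ hl₂).2 2
    have hmeet : ∀ y ∈ l₁, y ∈ l₂ → y = τ l₁ 0 := by
      intro y hy1 hy2
      by_contra hy
      exact hne12 (h.eq_of_mem l₁ (hL' hl₁) l₂ (hL' hl₂) y _ hy hy1 a0.1 hy2 (heq ▸ b0.1))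
    have hT := TriplesIn.of_two_lines h (hL' hl₁) (hL' hl₂) (htriple l₁ hl₁) (htriple l₂ hl₂)
      (by
        intro x
        simp only [mem_insert, mem_singleton]
        rintro (rfl | rfl | rfl)
        exacts [a0.1, a1.1, a2.1])
      (by
        intro x
        simp only [mem_insert, mem_singleton]
        rintro (rfl | rfl | rfl)
        exacts [b0.1, b1.1, b2.1])
      (by
        intro y hy1 hy2
        rw [hmeet y hy1 hy2]
        exact ⟨by simp, by simp [heq]⟩)
    have hdisj : ({τ l₁ 0, τ l₁ 1, τ l₁ 2} ∪ {τ l₂ 0, τ l₂ 1, τ l₂ 2} : Finset α).card = 5 := by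
      have hi : ({τ l₁ 0, τ l₁ 1, τ l₁ 2} ∩ {τ l₂ 0, τ l₂ 1, τ l₂ 2} : Finset α) = {τ l₁ 0} := by
        ext y
        rw [mem_inter, mem_singleton]
        constructor
        · rintro ⟨h1, h2⟩
          simp only [mem_insert, mem_singleton] at h1 h2
          refine hmeet y ?_ ?_
          · rcases h1 with rfl | rfl | rfl
            exacts [a0.1, a1.1, a2.1]
          · rcases h2 with rfl | rfl | rfl
            exacts [b0.1, b1.1, b2.1]
        · rintro rfl
          exact ⟨by simp, by simp [heq]⟩
      have := card_union_add_card_inter ({τ l₁ 0, τ l₁ 1, τ l₁ 2} : Finset α)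
        {τ l₂ 0, τ l₂ 1, τ l₂ 2}
      rw [hi, htriple l₁ hl₁, htriple l₂ hl₂, card_singleton] at this
      omega
    have hsub : ({τ l₁ 0, τ l₁ 1, τ l₁ 2} ∪ {τ l₂ 0, τ l₂ 1, τ l₂ 2} : Finset α) ⊆ V' := by
      intro x
      simp only [mem_union, mem_insert, mem_singleton]
      rintro ((rfl | rfl | rfl) | (rfl | rfl | rfl))
      exacts [a0.2.1, a1.2.1, a2.2.1, b0.2.1, b1.2.1, b2.2.1]
    obtain ⟨w, hwV, hw, hwQ, hQw⟩ := ext 0 hsub hdisj.le (by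
      rw [filter_union, filter_insert, filter_insert, filter_singleton, filter_insert,
        filter_insert, filter_singleton, a0.2.2, a1.2.2, a2.2.2, b0.2.2, b1.2.2, b2.2.2]
      simp [heq]) hT
    refine hasPattern_of_six ![τ l₁ 0, τ l₁ 1, τ l₁ 2, τ l₂ 1, τ l₂ 2, w] ?_
      (by rw [card_insert_of_notMem hwQ, hdisj]) (insert_subset hwV hsub |>.trans hV') ?_ ?_ hQw
    · rw [himg]
      ext x
      simp only [mem_insert, mem_union, mem_singleton, heq]
      tauto
    · simp only [mem_insert, mem_singleton, forall_eq_or_imp, forall_eq]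
      refine ⟨⟨l₁, hL' hl₁, ?_⟩, ⟨l₂, hL' hl₂, ?_⟩⟩
      · simp [a0.1, a1.1, a2.1]
      · simp [heq, b0.1, b1.1, b2.1]
    · simp [image_insert, heq]
  -- Since l is light, at most B·m lines meet it, fewer than L' contains.
  · obtain ⟨l', hl', hdis⟩ : ∃ l' ∈ L', ∀ y ∈ l, y ∉ l' := by
      by_contra! hcon
      have h1 : L' ⊆ l.biUnion fun y => L.filter fun k => y ∈ k := by
        intro k hk
        obtain ⟨y, hy, hyk⟩ := hcon k hk
        exact mem_biUnion.2 ⟨y, hy, mem_filter.2 ⟨hL' hk, hyk⟩⟩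
      have h2 : L'.card ≤ B * m := by
        calc L'.card ≤ ∑ y ∈ l, (L.filter fun k => y ∈ k).card :=
              (card_le_card h1).trans card_biUnion_le
          _ ≤ ∑ y ∈ l, m := sum_le_sum fun y _ => (h.card_filter_mem_le y).trans hm
          _ = l.card * m := by simp
          _ ≤ B * m := Nat.mul_le_mul_right _ (hτ l hl).1
      have : 26 * B * m = 26 * (B * m) := by ring
      omega
    have a := (hτ l hl).2
    have b := (hτ l' hl').2
    have hAl : ({τ l 0, τ l 1, τ l 2} : Finset α) ⊆ l := by
      intro x; simp only [mem_insert, mem_singleton]; rintro (rfl | rfl | rfl)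
      exacts [(a 0).1, (a 1).1, (a 2).1]
    have hBl : ({τ l' 0, τ l' 1, τ l' 2} : Finset α) ⊆ l' := by
      intro x; simp only [mem_insert, mem_singleton]; rintro (rfl | rfl | rfl)
      exacts [(b 0).1, (b 1).1, (b 2).1]
    have hT := TriplesIn.of_two_lines h (hL' hl) (hL' hl') (htriple l hl) (htriple l' hl')
      hAl hBl (fun y hy hy' => absurd hy' (hdis y hy))
    refine hasPattern_of_six ![τ l 0, τ l 1, τ l 2, τ l' 0, τ l' 1, τ l' 2] ?_ ?_ ?_ ?_ ?_ hT
    · rw [himg]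
      ext x
      simp only [mem_insert, mem_union, mem_singleton]
      tauto
    · rw [card_union_of_disjoint (disjoint_left.2 fun y hy hy' => hdis y (hAl hy) (hBl hy')),
        htriple l hl, htriple l' hl']
    · exact union_subset (hAl.trans (h.subset l (hL' hl))) (hBl.trans (h.subset l' (hL' hl')))
    · simp only [mem_insert, mem_singleton, forall_eq_or_imp, forall_eq]
      refine ⟨⟨l, hL' hl, ?_⟩, ⟨l', hL' hl', ?_⟩⟩
      · simp [(a _).1]
      · simp [(b _).1]
    · simp [image_insert]

end

end MatroidMinors

/-! ### Points, long lines and covers in ranks two and three -/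

namespace MatroidMinors
open Finset

section

variable {α : Type*} [DecidableEq α] {M : Matroid α}

theorem card_le_of_subset_closure {α : Type*} {M : Matroid α} {I A : Finset α} (hI : M.Indep I)
    (h : (I : Set α) ⊆ M.closure A) : I.card ≤ A.card := by
  have h1 := hI.encard_le_eRk_of_subset h
  rw [Matroid.eRk_closure_eq] at h1
  have h2 := h1.trans (M.eRk_le_encard A)
  rw [Set.encard_coe_eq_coe_finsetCard, Set.encard_coe_eq_coe_finsetCard] at h2
  exact_mod_cast h2

theorem mem_closure_of_not_indep {I : Finset α} (hI : M.Indep I) {x : α} (hx : x ∈ M.E)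
    (h : ¬ M.Indep (insert x I : Finset α)) : x ∈ M.closure I := by
  rw [hI.mem_closure_iff']
  rw [coe_insert] at h
  exact ⟨hx, fun h' => absurd h' h⟩

/-- If some x in J were outside the closure of I, then I + x would be an independent set larger than
J inside the closure of J. -/
theorem subset_closure_symm {I J : Finset α} (hI : M.Indep I) (hJ : M.Indep J)
    (hcard : J.card ≤ I.card) (h : (I : Set α) ⊆ M.closure J) : (J : Set α) ⊆ M.closure I := by
  intro x hx
  rw [hI.mem_closure_iff']
  refine ⟨hJ.subset_ground hx, fun hins => ?_⟩
  by_contra hxI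
  rw [mem_coe] at hxI
  rw [← coe_insert] at hins
  have := card_le_of_subset_closure (A := J) hins (by
    rw [coe_insert]
    exact Set.insert_subset (M.mem_closure_of_mem hx hJ.subset_ground) h)
  rw [card_insert_of_notMem hxI] at this
  omega

/-- All subsets of `V` with at most two elements are independent. -/
def IsSimpleOn (M : Matroid α) (V : Finset α) : Prop :=
  ∀ T ⊆ V, T.card ≤ 2 → M.Indep T

/-- A maximal simple set of points represents every nonloop up to parallelism. -/
theorem exists_isSimpleOn [Fintype α] (M : Matroid α) :
    ∃ V : Finset α, IsSimpleOn M V ∧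
      ∀ x, M.Indep ({x} : Finset α) → ∃ v ∈ V, x ∈ M.closure ({v} : Finset α) := by
  classical
  have hne : ((univ : Finset (Finset α)).filter (IsSimpleOn M)).Nonempty := by
    refine ⟨∅, mem_filter.2 ⟨mem_univ _, fun T hT _ => ?_⟩⟩
    rw [subset_empty.1 hT]
    simp
  obtain ⟨V, hV, hmax⟩ := exists_max_image _ Finset.card hne
  rw [mem_filter] at hV
  refine ⟨V, hV.2, fun x hx => ?_⟩
  have hxE : x ∈ M.E := hx.subset_ground (by simp)
  by_cases hxV : x ∈ V
  · exact ⟨x, hxV, M.mem_closure_of_mem (by simp) hx.subset_ground⟩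
  -- By maximality of V, adding x creates a dependent set of size at most two. As x is no loop, this
  -- is a pair {x, v}, so v is parallel to x.
  have hnot : ¬ IsSimpleOn M (insert x V) := by
    intro hs
    have := hmax _ (mem_filter.2 ⟨mem_univ _, hs⟩)
    rw [card_insert_of_notMem hxV] at this
    omega
  simp only [IsSimpleOn, not_forall] at hnot
  obtain ⟨T, hTV, hT2, hT⟩ := hnot
  have hxT : x ∈ T := by
    by_contra hxT
    refine hT (hV.2 T (fun y hy => (mem_insert.1 (hTV hy)).resolve_left ?_) hT2)
    rintro rfl
    exact hxT hy
  have hTx : (T.erase x).Nonempty := by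
    rw [nonempty_iff_ne_empty]
    intro h0
    rw [erase_eq_empty_iff] at h0
    rcases h0 with rfl | rfl
    · simp at hxT
    · exact hT hx
  obtain ⟨v, hv⟩ := hTx
  have hvT := mem_erase.1 hv
  have hvV : v ∈ V := (mem_insert.1 (hTV hvT.2)).resolve_left hvT.1
  have hTeq : T = insert x {v} := by
    symm
    refine eq_of_subset_of_card_le (insert_subset hxT (singleton_subset_iff.2 hvT.2)) ?_
    rw [card_pair hvT.1.symm]
    exact hT2
  refine ⟨v, hvV, mem_closure_of_not_indep (hV.2 _ (by simpa using hvV) (by simp)) hxE ?_⟩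
  rwa [← hTeq]

/-- The loops and the parallel classes of the elements of `V`, with their ranks. -/
noncomputable def pointBounds [Fintype α] (M : Matroid α) (V : Finset α) :
    Finset (Finset α × ℕ) :=
  open Classical in
  insert (univ.filter fun x => ¬ M.Indep ({x} : Finset α), 0)
    (V.image fun v => (univ.filter fun x => x ∈ M.closure ({v} : Finset α), 1))

theorem card_pointBounds_le [Fintype α] (M : Matroid α) (V : Finset α) :
    (pointBounds M V).card ≤ V.card + 1 := by
  classical
  unfold pointBounds
  exact (card_insert_le _ _).trans (Nat.succ_le_succ card_image_le)

theorem card_inter_filter_closure_le [Fintype α]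
    {I A : Finset α} [DecidablePred fun x => x ∈ M.closure A] (hI : M.Indep I) :
    (I ∩ univ.filter fun x => x ∈ M.closure A).card ≤ A.card := by
  refine card_le_of_subset_closure (M := M)
    (hI.subset (by exact_mod_cast inter_subset_left)) fun x hx => ?_
  rw [mem_coe, mem_inter, mem_filter] at hx
  exact hx.2.2

theorem pointBounds_sound [Fintype α] {V : Finset α} {p : Finset α × ℕ}
    (hp : p ∈ pointBounds M V) {I : Finset α} (hI : M.Indep I) : (I ∩ p.1).card ≤ p.2 := by
  classical
  unfold pointBounds at hp
  rw [mem_insert, mem_image] at hp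
  rcases hp with rfl | ⟨v, hv, rfl⟩
  · simp only [Nat.le_zero, card_eq_zero]
    rw [eq_empty_iff_forall_notMem]
    intro x hx
    rw [mem_inter, mem_filter] at hx
    refine hx.2.2 (hI.subset ?_)
    simpa using hx.1
  · exact card_inter_filter_closure_le hI

/-- A set of points covered by no loop or parallel class has distinct representatives in `V`. -/
theorem exists_injOn_of_not_pointBounds [Fintype α] {V : Finset α}
    (hV : ∀ x, M.Indep ({x} : Finset α) → ∃ v ∈ V, x ∈ M.closure ({v} : Finset α)) {X : Finset α}
    (hX : ∀ p ∈ pointBounds M V, (X ∩ p.1).card ≤ p.2) :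
    ∃ g : α → α, Set.InjOn g X ∧ ∀ x ∈ X, M.Indep ({x} : Finset α) ∧ g x ∈ V ∧
      x ∈ M.closure ({g x} : Finset α) := by
  classical
  have hind : ∀ x ∈ X, M.Indep ({x} : Finset α) := by
    intro x hx
    by_contra hcon
    have := hX _ (mem_insert_self _ _)
    simp only [Nat.le_zero, card_eq_zero] at this
    have hmem : x ∈ X ∩ univ.filter fun x => ¬ M.Indep ({x} : Finset α) :=
      mem_inter.2 ⟨hx, mem_filter.2 ⟨mem_univ _, hcon⟩⟩
    rw [this] at hmem
    simp at hmem
  have hex : ∀ x, ∃ v, x ∈ X → v ∈ V ∧ x ∈ M.closure ({v} : Finset α) := by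
    intro x
    by_cases hx : x ∈ X
    · obtain ⟨v, hv⟩ := hV x (hind x hx)
      exact ⟨v, fun _ => hv⟩
    · exact ⟨x, fun h => absurd h hx⟩
  choose g hg using hex
  refine ⟨g, ?_, fun x hx => ⟨hind x hx, hg x hx⟩⟩
  intro x hx y hy hxy
  rw [mem_coe] at hx hy
  have := hX _ (mem_insert_of_mem (mem_image_of_mem _ (hg x hx).1))
  refine card_le_one.1 this x (mem_inter.2 ⟨hx, mem_filter.2 ⟨mem_univ _, (hg x hx).2⟩⟩) y
    (mem_inter.2 ⟨hy, mem_filter.2 ⟨mem_univ _, ?_⟩⟩)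
  rw [hxy]
  exact (hg y hy).2

/-- In rank two the loops and parallel classes form a cover. -/
theorem isCover_two_pointBounds [Fintype α] {V : Finset α} (hs : IsSimpleOn M V)
    (hV : ∀ x, M.Indep ({x} : Finset α) → ∃ v ∈ V, x ∈ M.closure ({v} : Finset α)) :
    IsCover M 2 (pointBounds M V) := by
  refine ⟨fun p hp I hI => pointBounds_sound hp hI, fun X hXE hX2 hX => ?_⟩
  by_contra! hcon
  obtain ⟨g, hg, hgX⟩ := exists_injOn_of_not_pointBounds hV hcon
  have hgc : (X.image g).card = 2 := by rw [card_image_of_injOn hg, hX2]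
  have hgV : X.image g ⊆ V := image_subset_iff.2 fun x hx => (hgX x hx).2.1
  have hgi : M.Indep (X.image g) := hs _ hgV hgc.le
  obtain ⟨x, y, hxy, rfl⟩ := card_eq_two.1 hX2
  have hx := hgX x (by simp)
  have hy := hgX y (by simp)
  have hyx : y ∈ M.closure ({x} : Finset α) := by
    refine mem_closure_of_not_indep hx.1 (hy.1.subset_ground (by simp)) ?_
    rwa [show insert y ({x} : Finset α) = {x, y} from pair_comm y x]
  have gy : g y ∈ M.closure ({y} : Finset α) := by
    have := subset_closure_symm hy.1 (hs {g y} (by simpa using hy.2.1) (by simp)) (by simp)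
      (by simpa using hy.2.2)
    exact this (by simp)
  have hyx' : M.closure ({y} : Finset α) ⊆ M.closure ({x} : Finset α) :=
    M.closure_subset_closure_of_subset_closure (by simpa using hyx)
  have gx : g x ∈ M.closure ({x} : Finset α) := by
    have := subset_closure_symm hx.1 (hs {g x} (by simpa using hx.2.1) (by simp)) (by simp)
      (by simpa using hx.2.2)
    exact this (by simp)
  -- Both representatives lie in the closure of x, yet as distinct points of V they form an
  -- independent pair.
  have := card_le_of_subset_closure (A := {x}) hgi (by
    intro z hz
    rw [mem_coe, mem_image] at hz
    obtain ⟨w, hw, rfl⟩ := hz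
    rw [mem_insert, mem_singleton] at hw
    rcases hw with rfl | rfl
    · exact gx
    · exact hyx' gy)
  rw [hgc, card_singleton] at this
  omega

/-- The lines with at least three points spanned by `V`. -/
noncomputable def longLines (M : Matroid α) (V : Finset α) : Finset (Finset α) :=
  open Classical in
  (V.offDiag.image fun x => V.filter fun y => y ∈ M.closure ({x.1, x.2} : Finset α)).filter
    fun l => 3 ≤ l.card

theorem mem_longLines {V l : Finset α} : l ∈ longLines M V ↔ 3 ≤ l.card ∧ ∃ a ∈ V, ∃ b ∈ V,
    a ≠ b ∧ ∀ y, y ∈ l ↔ y ∈ V ∧ y ∈ M.closure ({a, b} : Finset α) := by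
  classical
  unfold longLines
  rw [mem_filter, mem_image, and_comm]
  refine and_congr_right fun _ => ?_
  constructor
  · rintro ⟨⟨a, b⟩, hab, rfl⟩
    rw [mem_offDiag] at hab
    exact ⟨a, hab.1, b, hab.2.1, hab.2.2, fun y => by simp⟩
  · rintro ⟨a, ha, b, hb, hab, h⟩
    refine ⟨(a, b), mem_offDiag.2 ⟨ha, hb, hab⟩, ?_⟩
    ext y
    rw [h y, mem_filter]

theorem isLinearSpace_longLines {V : Finset α} (hs : IsSimpleOn M V) :
    IsLinearSpace V (longLines M V) := by
  have key : ∀ a b p q : α, a ∈ V → b ∈ V → a ≠ b → p ∈ V → q ∈ V → p ≠ q →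
      p ∈ M.closure ({a, b} : Finset α) → q ∈ M.closure ({a, b} : Finset α) →
      M.closure ({a, b} : Finset α) = M.closure ({p, q} : Finset α) := by
    intro a b p q ha hb hab hp hq hpq hp' hq'
    have hpqs : (({p, q} : Finset α) : Set α) ⊆ M.closure ({a, b} : Finset α) := by
      intro z hz
      rw [mem_coe, mem_insert, mem_singleton] at hz
      rcases hz with rfl | rfl <;> assumption
    have hpair : ∀ {a b : α}, a ∈ V → b ∈ V → M.Indep ({a, b} : Finset α) := fun ha hb =>
      hs _ (insert_subset ha (singleton_subset_iff.2 hb)) card_le_two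
    refine (M.closure_subset_closure_of_subset_closure ?_).antisymm
      (M.closure_subset_closure_of_subset_closure hpqs)
    exact subset_closure_symm (hpair hp hq) (hpair ha hb) (by rw [card_pair hpq, card_pair hab]) hpqs
  refine ⟨fun l hl x hx => ?_, fun l hl => (mem_longLines.1 hl).1, ?_⟩
  · obtain ⟨-, a, -, b, -, -, h⟩ := mem_longLines.1 hl
    exact ((h x).1 hx).1
  · intro l hl l' hl' p q hpq hpl hql hpl' hql'
    obtain ⟨-, a, ha, b, hb, hab, h⟩ := mem_longLines.1 hl
    obtain ⟨-, a', ha', b', hb', hab', h'⟩ := mem_longLines.1 hl'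
    have hp := (h p).1 hpl
    have hq := (h q).1 hql
    ext y
    rw [h y, h' y, key a b p q ha hb hab hp.1 hq.1 hpq hp.2 hq.2,
      key a' b' p q ha' hb' hab' hp.1 hq.1 hpq ((h' p).1 hpl').2 ((h' q).1 hql').2]

theorem not_indep_of_subset_longLine {V l T : Finset α} (hl : l ∈ longLines M V) (hT : T ⊆ l)
    (hT3 : T.card = 3) : ¬ M.Indep T := by
  intro hTi
  obtain ⟨-, a, -, b, -, hab, h⟩ := mem_longLines.1 hl
  have := card_le_of_subset_closure hTi fun x hx => ((h x).1 (hT hx)).2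
  rw [card_pair hab] at this
  omega

theorem exists_longLine_of_not_indep {V T : Finset α} (hs : IsSimpleOn M V) (hTV : T ⊆ V)
    (hT3 : T.card = 3) (hT : ¬ M.Indep T) :
    ∃ l ∈ longLines M V, T ⊆ l := by
  classical
  obtain ⟨a, b, c, hab, hac, hbc, rfl⟩ := card_eq_three.1 hT3
  have ha : a ∈ V := hTV (by simp)
  have hb : b ∈ V := hTV (by simp)
  have hc : c ∈ V := hTV (by simp)
  have hi : M.Indep ({a, b} : Finset α) :=
    hs _ ((show ({a, b} : Finset α) ⊆ {a, b, c} by intro z; simp; tauto).trans hTV)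
      (by rw [card_pair hab])
  have hcE : c ∈ M.E := (hs {c} (by simpa using hc) (by simp)).subset_ground (by simp)
  have hcl : c ∈ M.closure ({a, b} : Finset α) := by
    refine mem_closure_of_not_indep hi hcE ?_
    rwa [show insert c ({a, b} : Finset α) = {a, b, c} by ext z; simp; tauto]
  have hsub : ({a, b, c} : Finset α) ⊆
      V.filter fun y => y ∈ M.closure ({a, b} : Finset α) := by
    intro z hz
    refine mem_filter.2 ⟨hTV hz, ?_⟩
    rw [mem_insert, mem_insert, mem_singleton] at hz
    rcases hz with rfl | rfl | rfl
    · exact M.mem_closure_of_mem (by simp) hi.subset_ground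
    · exact M.mem_closure_of_mem (by simp) hi.subset_ground
    · exact hcl
  refine ⟨_, mem_longLines.2 ⟨?_, a, ha, b, hb, hab, fun y => ?_⟩, hsub⟩
  · rw [← hT3]; exact card_le_card hsub
  · rw [mem_filter]

/-- In rank three a cover consists of the loops, the parallel classes and the long lines. -/
theorem exists_isCover_three [Fintype α] {V : Finset α} (hs : IsSimpleOn M V)
    (hV : ∀ x, M.Indep ({x} : Finset α) → ∃ v ∈ V, x ∈ M.closure ({v} : Finset α)) :
    ∃ Z, IsCover M 3 Z ∧ Z.card ≤ V.card + 1 + (longLines M V).card := by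
  classical
  refine ⟨pointBounds M V ∪ (longLines M V).image fun l : Finset α =>
    (univ.filter fun x => x ∈ M.closure l, 2), ⟨?_, ?_⟩, ?_⟩
  · intro p hp I hI
    rw [mem_union, mem_image] at hp
    rcases hp with hp | ⟨l, hl, rfl⟩
    · exact pointBounds_sound hp hI
    · obtain ⟨-, a, ha, b, hb, hab, h⟩ := mem_longLines.1 hl
      simp only
      rw [← card_pair hab]
      refine card_le_of_subset_closure (M := M)
        (hI.subset (by exact_mod_cast inter_subset_left)) fun x hx => ?_
      rw [mem_coe, mem_inter, mem_filter] at hx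
      exact M.closure_subset_closure_of_subset_closure (fun y hy => ((h y).1 hy).2) hx.2.2
  · intro X hXE hX3 hX
    by_cases hcov : ∃ p ∈ pointBounds M V, p.2 < (X ∩ p.1).card
    · obtain ⟨p, hp, hlt⟩ := hcov
      exact ⟨p, mem_union_left _ hp, hlt⟩
    push Not at hcov
    obtain ⟨g, hg, hgX⟩ := exists_injOn_of_not_pointBounds hV hcov
    have hgc : (X.image g).card = 3 := by rw [card_image_of_injOn hg, hX3]
    have hgV : X.image g ⊆ V := image_subset_iff.2 fun x hx => (hgX x hx).2.1
    have hXg : (X : Set α) ⊆ M.closure (X.image g) := by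
      intro x hx
      refine M.closure_subset_closure ?_ (hgX x hx).2.2
      simpa using ⟨x, hx, rfl⟩
    have hgX' : ((X.image g : Finset α) : Set α) ⊆ M.closure X := by
      intro y hy
      rw [mem_coe, mem_image] at hy
      obtain ⟨x, hx, rfl⟩ := hy
      have hgx := hgX x hx
      have := subset_closure_symm hgx.1 (hs {g x} (by simpa using hgx.2.1) (by simp)) (by simp)
        (by simpa using hgx.2.2)
      exact M.closure_subset_closure (by simpa using hx) (this (by simp))
    -- X and its set of representatives span the same flat and have the same size, so dependence of
    -- X passes to the representatives.
    have hdep : ¬ M.Indep (X.image g) := by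
      intro hi
      obtain ⟨J, hJ⟩ := M.exists_isBasis (X : Set α) hXE
      have hJX : J ⊆ X := hJ.subset
      have hJfin : J.Finite := X.finite_toSet.subset hJX
      lift J to Finset α using hJfin
      have h1 := card_le_of_subset_closure (A := J) hi (by rwa [hJ.closure_eq_closure])
      have h2 : J = X := eq_of_subset_of_card_le (by exact_mod_cast hJX) (by omega)
      exact hX (h2 ▸ hJ.indep)
    obtain ⟨l, hl, hgl⟩ := exists_longLine_of_not_indep hs hgV hgc hdep
    refine ⟨_, mem_union_right _ (mem_image_of_mem _ hl), ?_⟩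
    have : X ∩ (univ.filter fun x => x ∈ M.closure l) = X := by
      rw [inter_eq_left]
      intro x hx
      refine mem_filter.2 ⟨mem_univ _, M.closure_subset_closure ?_ (hXg hx)⟩
      exact_mod_cast hgl
    simp only [this]
    omega
  · refine (card_union_le _ _).trans ?_
    exact Nat.add_le_add (card_pointBounds_le M V) card_image_le

/-- A faithful embedding of a matroid on `Fin k` as a restriction. -/
theorem hasMinor_of_indep_iff {k : ℕ} {N : Matroid (Fin k)} (hN : N.E = Set.univ) {p : Fin k → α}
    (hp : Function.Injective p) (hpE : ∀ i, p i ∈ M.E)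
    (h : ∀ I : Finset (Fin k), M.Indep (I.image p) ↔ N.Indep I) : HasMinor M N := by
  have hR : Set.range p ⊆ M.E := Set.range_subset_iff.2 hpE
  refine ⟨M.restrict (Set.range p), ⟨∅, M.E \ Set.range p, ?_⟩, ?_⟩
  · rw [Matroid.contract_empty, Matroid.delete_eq_restrict, Set.sdiff_sdiff_cancel_left hR]
  let e : (M.restrict (Set.range p)).E ≃ N.E :=
    (Equiv.ofInjective p hp).symm.trans ((Equiv.Set.univ _).symm.trans (Equiv.setCongr hN.symm))
  have he : ∀ x, p (e x : Fin k) = x := fun x => by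
    simp only [e]
    exact Equiv.apply_ofInjective_symm hp x
  refine ⟨e, fun I => ?_⟩
  have h1 : (Subtype.val '' I : Set α) = p '' (Subtype.val '' (e '' I)) := by
    rw [Set.image_image, Set.image_image]
    exact Set.image_congr fun x _ => (he x).symm
  have h2 := h (Subtype.val '' (e '' I) : Set (Fin k)).toFinite.toFinset
  rw [coe_image, Set.Finite.coe_toFinset, ← h1] at h2
  rw [Matroid.restrict_indep_iff, h2]
  refine and_iff_left ?_
  rw [h1]
  exact Set.image_subset_range _ _

theorem HasRank.card_le {α : Type*} {M : Matroid α} {r : ℕ} (hM : HasRank M r) {I : Finset α}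
    (hI : M.Indep I) : I.card ≤ r := by
  obtain ⟨B, hB, rfl⟩ := hM
  refine card_le_of_subset_closure hI ?_
  rw [hB.closure_eq]
  exact hI.subset_ground

theorem hasMinor_uniform_two {V : Finset α} (hM : HasRank M 2) (hs : IsSimpleOn M V) {k : ℕ}
    (hk : k ≤ V.card) : HasMinor M (uniform 2 k) := by
  obtain ⟨p, hp, hpV⟩ : ∃ p : Fin k → α, Function.Injective p ∧ ∀ i, p i ∈ V :=
    ⟨fun i => V.equivFin.symm (Fin.castLE hk i), fun i j hij =>
      Fin.castLE_injective hk (V.equivFin.symm.injective (Subtype.ext hij)),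
      fun i => (V.equivFin.symm (Fin.castLE hk i)).2⟩
  refine hasMinor_of_indep_iff rfl hp (fun i =>
    (hs {p i} (by simpa using hpV i) (by simp)).subset_ground (by simp)) fun I => ?_
  rw [uniform_indep_iff, ← card_image_of_injective I hp]
  exact ⟨fun h => hM.card_le h, fun h => hs _ (image_subset_iff.2 fun i _ => hpV i) h⟩

/-- Restrict M to the six points. Pairs are independent by simplicity, sets of four or more are
dependent by rank, and triples are dependent exactly when a long line contains them. -/
theorem hasMinor_of_hasPattern {V : Finset α} (hM : HasRank M 3) (hs : IsSimpleOn M V)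
    {C : Finset (Finset (Fin 6))} (hC : ∀ A ∈ C, A.card = 3) {N : Matroid (Fin 6)}
    (hN : N.E = Set.univ) (hNC : ∀ I : Finset (Fin 6), N.Indep I ↔ I.card ≤ 3 ∧ I ∉ C)
    (hpat : HasPattern V (longLines M V) C) : HasMinor M N := by
  obtain ⟨p, hp, hpV, hpC⟩ := hpat
  refine hasMinor_of_indep_iff hN hp (fun i =>
    (hs {p i} (by simpa using hpV i) (by simp)).subset_ground (by simp)) fun I => ?_
  have hIV : I.image p ⊆ V := image_subset_iff.2 fun i _ => hpV i
  have hIc : (I.image p).card = I.card := card_image_of_injective I hp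
  rw [hNC]
  by_cases h2 : I.card ≤ 2
  · refine iff_of_true (hs _ hIV (by omega)) ⟨by omega, fun h => ?_⟩
    have := hC I h
    omega
  by_cases h3 : I.card = 3
  · rw [← hpC I h3]
    refine ⟨fun h => ⟨by omega, ?_⟩, fun h => ?_⟩
    · rintro ⟨l, hl, hIl⟩
      exact not_indep_of_subset_longLine hl (image_subset_iff.2 hIl) (by omega) h
    · by_contra hcon
      obtain ⟨l, hl, hIl⟩ := exists_longLine_of_not_indep hs hIV (by omega) hcon
      exact h.2 ⟨l, hl, fun i hi => hIl (mem_image_of_mem p hi)⟩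
  · refine iff_of_false (fun h => ?_) (fun h => by omega)
    have := hM.card_le h
    omega

end

end MatroidMinors

/-! ### Choice of the heavy-line threshold and conclusion -/

namespace MatroidMinors
open Finset Filter

/-- Threshold `⌈n ^ (2 / 5)⌉ + 1` for the number of heavy lines among `n` points. -/
noncomputable def heavyBound (n : ℕ) : ℕ := ⌈(n : ℝ) ^ (2 / 5 : ℝ)⌉₊ + 1

theorem mul_self_le_heavyBound (n : ℕ) :
    n * n ≤ heavyBound n * (heavyBound n * heavyBound n * (heavyBound n * heavyBound n)) := by
  have h1 : (n : ℝ) ^ (2 / 5 : ℝ) ≤ heavyBound n := by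
    unfold heavyBound
    push_cast
    linarith [Nat.le_ceil ((n : ℝ) ^ (2 / 5 : ℝ))]
  have h2 : ((n : ℝ) ^ (2 / 5 : ℝ)) ^ 5 = n * n := by
    rw [← Real.rpow_natCast, ← Real.rpow_mul (by positivity)]
    norm_num
    ring
  have h3 : (n : ℝ) * n ≤ (heavyBound n : ℝ) ^ 5 := by
    rw [← h2]
    gcongr
  have h4 : n * n ≤ heavyBound n ^ 5 := by exact_mod_cast h3
  calc n * n ≤ heavyBound n ^ 5 := h4
    _ = _ := by ring

/-- An upper bound for the number of long lines in the absence of some pattern. -/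
noncomputable def lineBound (n : ℕ) : ℕ :=
  heavyBound n + heavyBound n * heavyBound n * n +
    27 * (26 * (heavyBound n * heavyBound n) * n + n)

theorem tendsto_log_sq_div_rpow :
    Tendsto (fun n : ℕ => Real.log n ^ 2 / (n : ℝ) ^ (1 / 5 : ℝ)) atTop (nhds 0) := by
  have h := (isLittleO_log_rpow_rpow_atTop 2
    (show (0 : ℝ) < 1 / 5 by norm_num)).tendsto_div_nhds_zero.comp
    (tendsto_natCast_atTop_atTop (R := ℝ))
  refine h.congr fun n => ?_
  simp

/-- The line bound is O(n^(9/5)), so a factor n^(1/5) is left to beat log^2 n. The constant 10000 is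
crude. -/
theorem tendsto_lineBound :
    Tendsto (fun n : ℕ => (((n + 1 + lineBound n : ℕ) : ℝ) + 1) * Real.log n ^ 2 / (n : ℝ) ^ 2)
      atTop (nhds 0) := by
  have h := tendsto_log_sq_div_rpow.const_mul 10000
  rw [mul_zero] at h
  refine squeeze_zero' (Eventually.of_forall fun n => by positivity) ?_ h
  filter_upwards [eventually_ge_atTop 1] with n hn
  have hn1 : (1 : ℝ) ≤ n := by exact_mod_cast hn
  have hn0 : (0 : ℝ) < n := by linarith
  set y : ℝ := (n : ℝ) ^ (2 / 5 : ℝ) with hy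
  have hy1 : 1 ≤ y := Real.one_le_rpow hn1 (by norm_num)
  have hH : (heavyBound n : ℝ) ≤ 3 * y := by
    unfold heavyBound
    push_cast
    have := (Nat.ceil_lt_add_one (show 0 ≤ y by linarith)).le
    linarith
  have hH0 : (0 : ℝ) ≤ heavyBound n := by positivity
  -- Exponents: 2/5 + 2/5 + 1 + 1/5 = 2.
  have hyn : y * y * n * (n : ℝ) ^ (1 / 5 : ℝ) = n ^ 2 := by
    have e1 : (n : ℝ) = (n : ℝ) ^ (1 : ℝ) := (Real.rpow_one _).symm
    have e2 : y * y * (n : ℝ) ^ (1 : ℝ) * (n : ℝ) ^ (1 / 5 : ℝ) = (n : ℝ) ^ (2 : ℝ) := by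
      rw [hy, ← Real.rpow_add hn0, ← Real.rpow_add hn0, ← Real.rpow_add hn0]
      norm_num
    rw [Real.rpow_one] at e2
    rw [e2]
    norm_num
  have hHH : (heavyBound n : ℝ) * heavyBound n ≤ 9 * (y * y) := by nlinarith
  have hyy : 1 ≤ y * y := by nlinarith
  have hline : (((n + 1 + lineBound n : ℕ) : ℝ) + 1) ≤ 10000 * (y * y * n) := by
    unfold lineBound
    push_cast
    have h1 : (heavyBound n : ℝ) * heavyBound n * n ≤ 9 * (y * y) * n := by gcongr
    have h2 : (heavyBound n : ℝ) ≤ 3 * (y * y * n) := by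
      nlinarith [mul_nonneg (show 0 ≤ y by linarith) (show 0 ≤ y * n - 1 by nlinarith)]
    have h3 : (n : ℝ) ≤ y * y * n := by nlinarith
    nlinarith
  rw [← mul_div_assoc, div_le_div_iff₀ (by positivity) (by positivity)]
  calc (((n + 1 + lineBound n : ℕ) : ℝ) + 1) * Real.log n ^ 2 * (n : ℝ) ^ (1 / 5 : ℝ)
      ≤ 10000 * (y * y * n) * Real.log n ^ 2 * (n : ℝ) ^ (1 / 5 : ℝ) := by gcongr
    _ = 10000 * Real.log n ^ 2 * (y * y * n * (n : ℝ) ^ (1 / 5 : ℝ)) := by ring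
    _ = _ := by rw [hyn]

theorem tendsto_fractionWithoutMinor_uniform_two (k : ℕ) :
    Tendsto (fractionWithoutMinor (uniform 2 k)) atTop (nhds 0) := by
  refine tendsto_fractionWithoutMinor _ 1 (f := fun _ => (k : ℝ) + 1) (fun _ => by positivity) ?_ ?_
  · have h : Tendsto (fun n : ℕ => Real.log n ^ 2 / (n : ℝ)) atTop (nhds 0) :=
      (Real.isLittleO_pow_log_id_atTop (n := 2)).tendsto_div_nhds_zero.comp
        tendsto_natCast_atTop_atTop
    have h2 := h.const_mul ((k : ℝ) + 1 + 1)
    rw [mul_zero] at h2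
    refine h2.congr fun n => ?_
    rw [pow_one, mul_div_assoc]
  · intro n M hM hMN
    obtain ⟨V, hs, hV⟩ := exists_isSimpleOn M
    refine ⟨_, isCover_two_pointBounds hs hV, ?_⟩
    have hVk : V.card < k := by
      by_contra! hk
      exact hMN (hasMinor_uniform_two hM hs hk)
    have := card_pointBounds_le M V
    exact_mod_cast (show (pointBounds M V).card ≤ k + 1 by omega)

theorem tendsto_fractionWithoutMinor_of_pattern {C : Finset (Finset (Fin 6))}
    (hC : ∀ A ∈ C, A.card = 3) {N : Matroid (Fin 6)} (hN : N.E = Set.univ)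
    (hNC : ∀ I : Finset (Fin 6), N.Indep I ↔ I.card ≤ 3 ∧ I ∉ C)
    (hpat : ∀ {n : ℕ} {V : Finset (Fin n)} {L : Finset (Finset (Fin n))}, IsLinearSpace V L →
      lineBound n < L.card → HasPattern V L C) :
    Tendsto (fractionWithoutMinor N) atTop (nhds 0) := by
  refine tendsto_fractionWithoutMinor N 2 (f := fun n => ((n + 1 + lineBound n : ℕ) : ℝ))
    (fun _ => by positivity) tendsto_lineBound fun n M hM hMN => ?_
  obtain ⟨V, hs, hV⟩ := exists_isSimpleOn M
  obtain ⟨Z, hZ, hZc⟩ := exists_isCover_three hs hV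
  refine ⟨Z, hZ, ?_⟩
  have hVn : V.card ≤ n := (card_le_univ V).trans (by simp)
  have hL : (longLines M V).card ≤ lineBound n := by
    by_contra! hlt
    exact hMN (hasMinor_of_hasPattern hM hs hC hN hNC (hpat (isLinearSpace_longLines hs) hlt))
  exact_mod_cast (show Z.card ≤ n + 1 + lineBound n by omega)

/-- With B = H^2 the losses H^2·n and B·n balance. The heavy-line condition n^2 ≤ H·B^2 = H^5 then
dictates H ≈ n^(2/5). -/
theorem hasPattern_of_lineBound_lt {n : ℕ} {V : Finset (Fin n)} {L : Finset (Finset (Fin n))}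
    (h : IsLinearSpace V L) (hL : lineBound n < L.card) :
    HasPattern V L ∅ ∧ HasPattern V L {{0, 1, 2}} ∧ HasPattern V L {{0, 1, 2}, {0, 3, 4}} ∧
      HasPattern V L {{0, 1, 2}, {3, 4, 5}} :=
  h.hasPattern (m := n) (B := heavyBound n * heavyBound n) (H := heavyBound n)
    ((card_le_univ V).trans (by simp))
    (Nat.mul_pos (Nat.succ_pos _) (Nat.succ_pos _)) (mul_self_le_heavyBound n) hL

end MatroidMinors

theorem theorem1p2 :
    (∀ k : ℕ, 2 ≤ k →
      Filter.Tendsto (MatroidMinors.fractionWithoutMinor (MatroidMinors.uniform 2 k))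
        Filter.atTop (nhds 0)) ∧
    Filter.Tendsto (MatroidMinors.fractionWithoutMinor (MatroidMinors.uniform 3 6))
      Filter.atTop (nhds 0) ∧
    Filter.Tendsto (MatroidMinors.fractionWithoutMinor MatroidMinors.P6)
      Filter.atTop (nhds 0) ∧
    Filter.Tendsto (MatroidMinors.fractionWithoutMinor MatroidMinors.Q6)
      Filter.atTop (nhds 0) ∧
    Filter.Tendsto (MatroidMinors.fractionWithoutMinor MatroidMinors.R6)
      Filter.atTop (nhds 0) := by
  open MatroidMinors in
  refine ⟨fun k _ => tendsto_fractionWithoutMinor_uniform_two k, ?_, ?_, ?_, ?_⟩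
  · exact tendsto_fractionWithoutMinor_of_pattern (C := ∅) (by simp) rfl
      (fun I => by rw [uniform_indep_iff]; simp)
      fun h hL => (hasPattern_of_lineBound_lt h hL).1
  · exact tendsto_fractionWithoutMinor_of_pattern (by decide) rfl sparsePaving_indep_iff
      fun h hL => (hasPattern_of_lineBound_lt h hL).2.1
  · exact tendsto_fractionWithoutMinor_of_pattern (by decide) rfl sparsePaving_indep_iff
      fun h hL => (hasPattern_of_lineBound_lt h hL).2.2.1
  · exact tendsto_fractionWithoutMinor_of_pattern (by decide) rfl sparsePaving_indep_iff
      fun h hL => (hasPattern_of_lineBound_lt h hL).2.2.2
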